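/- There is an absolute constant $C>1$ such that the following holds for every sequence $p=p(n)\in[0,1]$ with $C\log n/n\le p(n)\le 0.99$ for all sufficiently large $n$. Let $G\sim G(n,p(n))$ be the binomial random graph on $n$ vertices, in which each pair of vertices is an edge independently with probability $p(n)$. Then, with probability tending to $1$ as $n\to\infty$, for every vertex $r$ of $G$ there are $\delta(G)$ distinct independent spanning trees of $G$ rooted at $r$, where $\delta(G)$ is the minimum degree of $G$. Moreover, with probability tending to $1$, $\kappa(G)=\delta(G)$, and consequently, with probability tending to $1$, $G$ satisfies the Zehavi–Itai conjecture: for every vertex $r$ there are $\kappa(G)$ distinct independent spanning trees of $G$ rooted at $r$. Here $\log$ is the natural logarithm. Spanning trees $T_1,\dots,T_k$ of $G$ are independent and rooted at $r$ if, for every vertex $v$ and all $i\ne j$, the unique $r$–$v$ paths in $T_i$ and $T_j$ share no vertices other than $r$ and $v$. The connectivity $\kappa(G)$ is the largest $k$ such that $G$ has more than $k$ vertices and deleting any fewer than $k$ vertices leaves a connected graph. -/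

import Mathlib

open Filter Topology unitInterval
open scoped SimpleGraph

namespace IST

/-- The minimum degree `δ(G)` of a finite graph. -/
noncomputable def minDeg {V : Type*} [Fintype V] (G : SimpleGraph V) : ℕ :=
  letI : DecidableRel G.Adj := Classical.decRel G.Adj
  G.minDegree

/-- `G` is `k`-connected: it has more than `k` vertices, and deleting any fewer than `k` of them
leaves a connected graph. -/
def IsVertexConnected {V : Type*} [Fintype V] (G : SimpleGraph V) (k : ℕ) : Prop :=
  k < Fintype.card V ∧
    ∀ X : Finset V, X.card < k → (G.induce {v : V | v ∉ X}).Connected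

/-- The vertex-connectivity `κ(G)`: the largest `k` for which `G` is `k`-connected
(these `k` are bounded by the number of vertices). -/
noncomputable def connectivity {V : Type*} [Fintype V] (G : SimpleGraph V) : ℕ :=
  sSup {k : ℕ | IsVertexConnected G k}

/-- The family `T` consists of independent spanning trees of `G` rooted at `r`: every `T i` is a
spanning tree of `G` (a tree on the whole vertex set all of whose edges are edges of `G`), and for
every vertex `v`, the `r`–`v` paths in two different members of the family share no vertices other
than `r` and `v`. -/
structure IsIndependent {V ι : Type*} (G : SimpleGraph V) (r : V) (T : ι → SimpleGraph V) :
    Prop where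
  le : ∀ i, T i ≤ G
  isTree : ∀ i, (T i).IsTree
  internally_disjoint : ∀ i j, i ≠ j → ∀ (v : V) (P : (T i).Walk r v) (Q : (T j).Walk r v),
    P.IsPath → Q.IsPath → ∀ x, x ∈ P.support → x ∈ Q.support → x = r ∨ x = v

/-- `G` contains `k` (distinct) independent spanning trees rooted at `r`. -/
def HasISTs {V : Type*} (G : SimpleGraph V) (r : V) (k : ℕ) : Prop :=
  ∃ T : Fin k → SimpleGraph V, Function.Injective T ∧ IsIndependent G r T

/-- The conclusion of the Zehavi–Itai conjecture for `G`: for every vertex `r` there are `κ(G)`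
independent spanning trees rooted at `r`. -/
def ZehaviItai {V : Type*} [Fintype V] (G : SimpleGraph V) : Prop :=
  ∀ r : V, HasISTs G r (connectivity G)

/-- For `G ~ G(n, p n)`, the property `A` holds with high probability: its probability tends to `1`
as the number `n` of vertices tends to infinity. -/
def Whp (p : ℕ → I) (A : ∀ n : ℕ, SimpleGraph (Fin n) → Prop) : Prop :=
  Tendsto (fun n : ℕ => G(Fin n, p n) {G | A n G}) atTop (𝓝 1)

end IST

namespace IST

/-! Fix a root r. Give every neighbour x of r a core A x: the cores are disjoint, avoid r, contain
x, and carry a rank ρ that can be decreased inside A x, along edges, until x is reached. For each x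
in a set X of δ(G) neighbours of r, build a tree. Neighbours of r hang from r, a vertex with a
neighbour in A x hangs from such a neighbour of least rank, and any other v hangs from a chosen
neighbour g v x that is adjacent to r or has a neighbour in A x. The path from v to r in this tree
makes at most one step outside A x before it descends through A x or reaches r directly.
Independence thus becomes a local condition at v, `IsMatched`: the vertices g v x are distinct and
differ from the parents of v that lie in cores (`hasISTs_of_isMatched`).

Finding g v is a bipartite matching problem between the cores that v misses and the neighbours of v
not yet used as parents. As |X| = δ(G) ≤ deg v, there are always enough of these neighbours
(`card_missed_le_card_available`). If Hall's condition fails, some set T of neighbours of v sends no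
edge to the cores of some set J. The pair (T, J) is encoded by v and two vertex sets P, R with |R| ≤
|P|, and forbids at least on the order of |P|·m·a edges, where m bounds the number of missed cores
from below and a the number of usable pairs between a vertex and a core. When p·a·m ≥ 40 log n each
encoding has probability at most n^(-10|P|), which survives the union bound.

The cores, T and J depend on the graph, so the forbidden pairs form a random set. The estimate
remains valid because this set is determined by the edges outside itself: `IsFree` expresses this,
and `IsFree.prob_le` is the resulting exponential moment bound.

Cores are chosen according to density. If p²n ≥ 10⁸ log n, take A x = {x}: codegrees are clearly
below δ(G), so every v misses many cores. Otherwise p < 10⁻⁴, and A x also receives connected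
segments of a vertices from three small reservoirs, assigned to neighbours of r by another Hall
argument.

Finally κ(G) = δ(G) is deterministic given the trees: δ(G) internally disjoint paths cannot all be
cut by fewer vertices. -/

/-! ### Trees defined by parent maps -/

/-- The graph whose edges join every vertex to its parent. -/
def parentGraph {V : Type*} (π : V → V) : SimpleGraph V :=
  SimpleGraph.fromRel fun u v => π u = v

lemma parentGraph_adj {V : Type*} {π : V → V} {u v : V} :
    (parentGraph π).Adj u v ↔ u ≠ v ∧ (π u = v ∨ π v = u) := by
  simp [parentGraph]

lemma parentGraph_exists_walk {V : Type*} {π : V → V} {r : V} {h : V → ℕ}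
    (hh : ∀ v, v ≠ r → h (π v) < h v) {S : Set V} (hS : ∀ u ∈ S, u ≠ r → π u ∈ S) :
    ∀ v ∈ S, ∃ W : (parentGraph π).Walk r v, ∀ x ∈ W.support, x ∈ S := by
  suffices H : ∀ m : ℕ, ∀ v ∈ S, h v = m →
      ∃ W : (parentGraph π).Walk r v, ∀ x ∈ W.support, x ∈ S from
    fun v hv => H _ v hv rfl
  intro m
  induction m using Nat.strong_induction_on with
  | _ m ih =>
    intro v hv hm
    by_cases hvr : v = r
    · subst hvr
      exact ⟨.nil, by simpa using hv⟩
    · have hlt := hh v hvr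
      obtain ⟨W, hW⟩ := ih _ (hm ▸ hlt) (π v) (hS v hv hvr) rfl
      have hadj : (parentGraph π).Adj (π v) v :=
        parentGraph_adj.2 ⟨fun e => by rw [e] at hlt; exact lt_irrefl _ hlt, Or.inr rfl⟩
      refine ⟨W.concat hadj, fun x hx => ?_⟩
      rw [SimpleGraph.Walk.support_concat] at hx
      simp only [List.mem_append, List.mem_singleton] at hx
      rcases hx with hx | rfl
      · exact hW x hx
      · exact hv

/-- The decreasing height connects every vertex to r, and every edge has the form {v, π v} with v ≠
r, so a connected graph on n vertices has at most n - 1 edges. -/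
lemma parentGraph_isTree {V : Type*} [Finite V] {π : V → V} {r : V} {h : V → ℕ}
    (hh : ∀ v, v ≠ r → h (π v) < h v) (hr : π r = r) : (parentGraph π).IsTree := by
  classical
  have hconn : (parentGraph π).Connected := by
    have : Nonempty V := ⟨r⟩
    refine SimpleGraph.Connected.mk fun u v => ?_
    obtain ⟨W, -⟩ := parentGraph_exists_walk hh (S := Set.univ) (by simp) u trivial
    obtain ⟨W', -⟩ := parentGraph_exists_walk hh (S := Set.univ) (by simp) v trivial
    exact ⟨W.reverse.append W'⟩
  have := Fintype.ofFinite V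
  rw [SimpleGraph.isTree_iff_connected_and_card]
  refine ⟨hconn, le_antisymm ?_ hconn.card_vert_le_card_edgeSet_add_one⟩
  have hsub : (parentGraph π).edgeSet ⊆ (fun v => s(v, π v)) '' ({r}ᶜ : Set V) := by
    intro e
    induction e using Sym2.ind with
    | _ u v =>
      intro he
      rw [SimpleGraph.mem_edgeSet, parentGraph_adj] at he
      obtain ⟨hne, h1 | h1⟩ := he
      · refine ⟨u, ?_, by simp [h1]⟩
        rintro rfl
        exact hne (hr.symm.trans h1)
      · refine ⟨v, ?_, by simp [h1, Sym2.eq_swap]⟩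
        rintro rfl
        exact hne (h1.symm.trans hr)
  have h1 : (parentGraph π).edgeSet.ncard ≤ ({r}ᶜ : Set V).ncard :=
    (Set.ncard_le_ncard hsub (Set.toFinite _)).trans (Set.ncard_image_le (Set.toFinite _))
  have h2 : ({r}ᶜ : Set V).ncard + 1 = Nat.card V := by
    have := Set.ncard_add_ncard_compl ({r} : Set V)
    rw [Set.ncard_singleton] at this
    omega
  rw [Nat.card_coe_set_eq]
  omega

/-- Paths in a tree are unique, so a set containing v and closed under parents (except at r)
contains the whole path. This bounds tree paths without computing them. -/
lemma parentGraph_path_support {V : Type*} [Finite V] {π : V → V} {r : V} {h : V → ℕ}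
    (hh : ∀ v, v ≠ r → h (π v) < h v) (hr : π r = r) {S : Set V}
    (hS : ∀ u ∈ S, u ≠ r → π u ∈ S) {v : V} (hv : v ∈ S) (P : (parentGraph π).Walk r v)
    (hP : P.IsPath) : ∀ x ∈ P.support, x ∈ S := by
  classical
  obtain ⟨W, hW⟩ := parentGraph_exists_walk hh hS v hv
  have := (parentGraph_isTree hh hr).isAcyclic.subsingleton_path r v |>.elim ⟨P, hP⟩ W.toPath
  have hPW : P = W.toPath := congrArg Subtype.val this
  intro x hx
  rw [hPW] at hx
  exact hW x (W.support_bypass_subset_support hx)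

/-! ### The deterministic criterion for independent spanning trees -/

open Classical in
/-- The neighbours of `v`, as a finite set. -/
noncomputable def nb {V : Type*} [Fintype V] (G : SimpleGraph V) (v : V) : Finset V :=
  Finset.univ.filter (G.Adj v)

@[simp] lemma mem_nb {V : Type*} [Fintype V] {G : SimpleGraph V} {v w : V} :
    w ∈ nb G v ↔ G.Adj v w := by
  simp [nb]

open Classical in
/-- A neighbour of `v` in `B` with the least value of `ρ`, if there is a neighbour in `B`. -/
noncomputable def lowNbr {V : Type*} (G : SimpleGraph V) (ρ : V → ℕ) (B : Finset V) (v : V) : V :=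
  if h : ∃ w ∈ B, G.Adj v w ∧ ∀ z ∈ B, G.Adj v z → ρ w ≤ ρ z then h.choose else v

lemma lowNbr_spec {V : Type*} {G : SimpleGraph V} {ρ : V → ℕ} {B : Finset V} {v : V}
    (h : ∃ w ∈ B, G.Adj v w) :
    lowNbr G ρ B v ∈ B ∧ G.Adj v (lowNbr G ρ B v) ∧
      ∀ z ∈ B, G.Adj v z → ρ (lowNbr G ρ B v) ≤ ρ z := by
  classical
  have h' : ∃ w ∈ B, G.Adj v w ∧ ∀ z ∈ B, G.Adj v z → ρ w ≤ ρ z := by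
    obtain ⟨w, hw, hvw⟩ := h
    obtain ⟨m, hm, hmin⟩ := Finset.exists_min_image (B.filter (G.Adj v)) ρ
      ⟨w, Finset.mem_filter.2 ⟨hw, hvw⟩⟩
    rw [Finset.mem_filter] at hm
    exact ⟨m, hm.1, hm.2, fun z hz hvz => hmin z (Finset.mem_filter.2 ⟨hz, hvz⟩)⟩
  rw [lowNbr, dif_pos h']
  exact ⟨h'.choose_spec.1, h'.choose_spec.2.1, h'.choose_spec.2.2⟩

/-- Disjoint sets `A x`, one for each neighbour `x` of the root `r`, such that every vertex of `A x`
is joined to `x` inside `A x` by a path along which `ρ` decreases. -/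
structure IsRooted {V : Type*} (G : SimpleGraph V) (r : V) (A : V → Finset V) (ρ : V → ℕ) :
    Prop where
  self_mem : ∀ x, G.Adj r x → x ∈ A x
  disj : ∀ x y, G.Adj r x → G.Adj r y → x ≠ y → Disjoint (A x) (A y)
  root_notMem : ∀ x, G.Adj r x → r ∉ A x
  descend : ∀ x, G.Adj r x → ∀ u ∈ A x, u ≠ x → ∃ w ∈ A x, G.Adj u w ∧ ρ w < ρ u

open Classical in
/-- The parent of `u` in the spanning tree that contains `A x`. -/
noncomputable def treeParent {V : Type*} (G : SimpleGraph V) (r : V) (A : V → Finset V)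
    (ρ : V → ℕ) (g : V → V → V) (x u : V) : V :=
  if u = r ∨ G.Adj r u then r
  else if ∃ w ∈ A x, G.Adj u w then lowNbr G ρ (A x) u
  else g u x

open Classical in
/-- A potential that decreases along `treeParent`. -/
noncomputable def treeHeight {V : Type*} (G : SimpleGraph V) (r : V) (A : V → Finset V)
    (ρ : V → ℕ) (R : ℕ) (x u : V) : ℕ :=
  if u = r then 0
  else if G.Adj r u then 1
  else if u ∈ A x then ρ u + 2
  else if ∃ w ∈ A x, G.Adj u w then R + 3
  else R + 4

/-- The condition on the parents `g` of a vertex `v` in those trees whose core `A x` contains no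
neighbour of `v`. -/
structure IsMatched {V : Type*} (G : SimpleGraph V) (r : V) (A : V → Finset V) (ρ : V → ℕ)
    (X : Finset V) (v : V) (g : V → V) : Prop where
  inj : ∀ x ∈ X, ∀ y ∈ X, (∀ w ∈ A x, ¬ G.Adj v w) → (∀ w ∈ A y, ¬ G.Adj v w) → g x = g y → x = y
  adj : ∀ x ∈ X, (∀ w ∈ A x, ¬ G.Adj v w) → G.Adj v (g x)
  ne : ∀ x ∈ X, (∀ w ∈ A x, ¬ G.Adj v w) → ∀ y ∈ X, (∃ w ∈ A y, G.Adj v w) →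
    g x ≠ lowNbr G ρ (A y) v
  attach : ∀ x ∈ X, (∀ w ∈ A x, ¬ G.Adj v w) → G.Adj r (g x) ∨ ∃ b ∈ A x, G.Adj (g x) b

/-- Two paths to v in different trees could meet outside r and v only inside a common core or at a
vertex g v x. Disjointness of cores excludes the first; `IsMatched` and the minimality in `lowNbr`
exclude the second. The non-neighbour v₀ serves only to show that the trees are distinct. -/
theorem hasISTs_of_isMatched {V : Type*} [Fintype V] {G : SimpleGraph V} {r : V}
    {A : V → Finset V} {ρ : V → ℕ} (hA : IsRooted G r A ρ) {X : Finset V}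
    (hX : ∀ x ∈ X, G.Adj r x) {v₀ : V} (hv₀ : v₀ ≠ r) (hv₀r : ¬ G.Adj r v₀)
    {g : V → V → V}
    (hg : ∀ v, v ≠ r → ¬ G.Adj r v → IsMatched G r A ρ X v (g v)) :
    HasISTs G r X.card := by
  classical
  obtain ⟨R, hR⟩ : ∃ R, ∀ u, ρ u ≤ R := ⟨Finset.univ.sup ρ, fun u => Finset.le_sup (by simp)⟩
  have par_r : ∀ x, treeParent G r A ρ g x r = r := fun x => by simp [treeParent]
  have par_adj : ∀ x u, G.Adj r u → treeParent G r A ρ g x u = r := fun x u hu => by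
    simp [treeParent, hu]
  have par_low : ∀ x u, u ≠ r → ¬ G.Adj r u → (∃ w ∈ A x, G.Adj u w) →
      treeParent G r A ρ g x u = lowNbr G ρ (A x) u := fun x u h1 h2 h3 => by
    rw [treeParent, if_neg (by tauto), if_pos h3]
  have par_g : ∀ x u, u ≠ r → ¬ G.Adj r u → (¬ ∃ w ∈ A x, G.Adj u w) →
      treeParent G r A ρ g x u = g u x := fun x u h1 h2 h3 => by
    rw [treeParent, if_neg (by tauto), if_neg h3]
  -- The layers of `treeHeight` are r, its neighbours, the core ordered by ρ (at most R + 2),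
  -- vertices attached to the core, and the rest. Each parent lies in a lower layer or has smaller ρ
  -- in the core.
  have hgt : ∀ x ∈ X, ∀ u, u ≠ r →
      treeHeight G r A ρ R x (treeParent G r A ρ g x u) < treeHeight G r A ρ R x u := by
    intro x hx u hur
    by_cases h1 : G.Adj r u
    · rw [par_adj x u h1]
      simp [treeHeight, hur, h1]
    have hux : u ≠ x := by rintro rfl; exact h1 (hX _ hx)
    by_cases h2 : ∃ w ∈ A x, G.Adj u w
    · rw [par_low x u hur h1 h2]
      obtain ⟨hm, -, hmin⟩ := lowNbr_spec (ρ := ρ) h2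
      have hle : treeHeight G r A ρ R x (lowNbr G ρ (A x) u) ≤ ρ (lowNbr G ρ (A x) u) + 2 := by
        unfold treeHeight
        split_ifs <;> omega
      have := hR (lowNbr G ρ (A x) u)
      by_cases h3 : u ∈ A x
      · obtain ⟨w, hw, huw, hlt⟩ := hA.descend x (hX x hx) u h3 hux
        have h4 := hmin w hw huw
        have : treeHeight G r A ρ R x u = ρ u + 2 := by simp [treeHeight, hur, h1, h3]
        omega
      · have : treeHeight G r A ρ R x u = R + 3 := by
          rw [treeHeight, if_neg hur, if_neg h1, if_neg h3, if_pos h2]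
        omega
    · rw [par_g x u hur h1 h2]
      have h2' : ∀ w ∈ A x, ¬ G.Adj u w := by push Not at h2; exact h2
      have h3 : u ∉ A x := fun h3 => by
        obtain ⟨w, hw, huw, -⟩ := hA.descend x (hX x hx) u h3 hux
        exact h2' w hw huw
      have hu : treeHeight G r A ρ R x u = R + 4 := by
        rw [treeHeight, if_neg hur, if_neg h1, if_neg h3, if_neg h2]
      have hM := hg u hur h1
      have h4 : g u x ∉ A x := fun h4 => h2' _ h4 (hM.adj x hx h2')
      rw [hu]
      unfold treeHeight
      rcases hM.attach x hx h2' with h5 | h5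
      · split_ifs <;> omega
      · rw [if_pos h5]
        split_ifs <;> omega
  have hle : ∀ x ∈ X, parentGraph (treeParent G r A ρ g x) ≤ G := by
    intro x hx
    have key : ∀ u, u ≠ treeParent G r A ρ g x u → G.Adj u (treeParent G r A ρ g x u) := by
      intro u hu
      by_cases hur : u = r
      · subst hur; exact absurd (par_r x).symm hu
      by_cases h1 : G.Adj r u
      · rw [par_adj x u h1]; exact h1.symm
      by_cases h2 : ∃ w ∈ A x, G.Adj u w
      · rw [par_low x u hur h1 h2]
        exact (lowNbr_spec h2).2.1
      · rw [par_g x u hur h1 h2]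
        exact (hg u hur h1).adj x hx (by push Not at h2; exact h2)
    intro u v huv
    obtain ⟨hne, h | h⟩ := parentGraph_adj.1 huv
    · subst h; exact key u hne
    · subst h; exact (key v hne.symm).symm
  have hstep : ∀ x ∈ X, ∀ z ∈ A x, z ≠ r → treeParent G r A ρ g x z = r ∨
      (treeParent G r A ρ g x z ∈ A x ∧ ρ (treeParent G r A ρ g x z) < ρ z) := by
    intro x hx z hz hzr
    by_cases h1 : G.Adj r z
    · exact Or.inl (par_adj x z h1)
    · right
      have hzx : z ≠ x := by rintro rfl; exact h1 (hX _ hx)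
      obtain ⟨w, hw, hzw, hlt⟩ := hA.descend x (hX x hx) z hz hzx
      have h2 : ∃ w ∈ A x, G.Adj z w := ⟨w, hw, hzw⟩
      rw [par_low x z hzr h1 h2]
      obtain ⟨hm, -, hmin⟩ := lowNbr_spec (ρ := ρ) h2
      exact ⟨hm, (hmin w hw hzw).trans_lt hlt⟩
  -- If v has a neighbour in A x, its path uses the lowest such neighbour and core vertices of
  -- strictly smaller rank. If not, it uses g v x and possibly core vertices.
  have hsupp : ∀ x ∈ X, ∀ v (P : (parentGraph (treeParent G r A ρ g x)).Walk r v), P.IsPath →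
      ∀ z ∈ P.support, z = r ∨ z = v ∨ (v ≠ r ∧ ¬ G.Adj r v ∧
        (((∃ w ∈ A x, G.Adj v w) ∧ z ∈ A x ∧
            (z = lowNbr G ρ (A x) v ∨ ρ z < ρ (lowNbr G ρ (A x) v))) ∨
          ((∀ w ∈ A x, ¬ G.Adj v w) ∧ (z = g v x ∨ z ∈ A x)))) := by
    intro x hx v P hP
    refine parentGraph_path_support (hgt x hx) (par_r x) (S := {z | z = r ∨ z = v ∨
      (v ≠ r ∧ ¬ G.Adj r v ∧
        (((∃ w ∈ A x, G.Adj v w) ∧ z ∈ A x ∧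
            (z = lowNbr G ρ (A x) v ∨ ρ z < ρ (lowNbr G ρ (A x) v))) ∨
          ((∀ w ∈ A x, ¬ G.Adj v w) ∧ (z = g v x ∨ z ∈ A x))))})
      ?_ (Or.inr (Or.inl rfl)) P hP
    intro u hu hur
    by_cases hru : G.Adj r u
    · exact Or.inl (par_adj x u hru)
    rcases hu with hu | rfl | ⟨hvr, hrv, hu⟩
    · exact absurd hu hur
    · right; right
      refine ⟨hur, hru, ?_⟩
      by_cases h2 : ∃ w ∈ A x, G.Adj u w
      · left
        rw [par_low x u hur hru h2]
        exact ⟨h2, (lowNbr_spec h2).1, Or.inl rfl⟩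
      · right
        rw [par_g x u hur hru h2]
        push Not at h2
        exact ⟨h2, Or.inl rfl⟩
    · rcases hu with ⟨h2, hux, hu⟩ | ⟨h2, rfl | hux⟩
      · rcases hstep x hx u hux hur with h3 | ⟨h3, h4⟩
        · exact Or.inl h3
        · refine Or.inr (Or.inr ⟨hvr, hrv, Or.inl ⟨h2, h3, Or.inr ?_⟩⟩)
          rcases hu with rfl | hu
          · exact h4
          · exact h4.trans hu
      · rcases (hg v hvr hrv).attach x hx h2 with h3 | h3
        · exact absurd h3 hru
        · refine Or.inr (Or.inr ⟨hvr, hrv, Or.inr ⟨h2, Or.inr ?_⟩⟩)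
          rw [par_low x _ hur hru h3]
          exact (lowNbr_spec h3).1
      · rcases hstep x hx u hux hur with h3 | ⟨h3, h4⟩
        · exact Or.inl h3
        · exact Or.inr (Or.inr ⟨hvr, hrv, Or.inr ⟨h2, Or.inr h3⟩⟩)
  let e : Fin X.card ≃ X := X.equivFin.symm
  let T : Fin X.card → SimpleGraph V := fun i => parentGraph (treeParent G r A ρ g (e i))
  have hind : IsIndependent G r T := by
    refine ⟨fun i => hle _ (e i).2, fun i => parentGraph_isTree (hgt _ (e i).2) (par_r _), ?_⟩
    intro i j hij v P Q hP hQ z hzP hzQ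
    have hne : (e i : V) ≠ e j := fun h => hij (e.injective (Subtype.ext h))
    have hx := (e i).2
    have hy := (e j).2
    have h1 := hsupp _ hx v P hP z hzP
    have h2 := hsupp _ hy v Q hQ z hzQ
    by_contra hz
    push Not at hz
    obtain ⟨hzr, hzv⟩ := hz
    have h1 := (h1.resolve_left hzr).resolve_left hzv
    have h2 := (h2.resolve_left hzr).resolve_left hzv
    obtain ⟨hvr, hrv, h1⟩ := h1
    obtain ⟨-, -, h2⟩ := h2
    have hM := hg v hvr hrv
    have hdisj : ∀ z, z ∈ A (e i) → z ∈ A (e j) → False := fun z h h' =>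
      Finset.disjoint_left.1 (hA.disj _ _ (hX _ hx) (hX _ hy) hne) h h'
    -- The parent g v b may lie in another core A a. It is a neighbour of v there, so its rank is at
    -- least that of the lowest neighbour, whereas the path in tree a has strictly smaller ranks
    -- after that neighbour.
    have hmix : ∀ a ∈ X, ∀ b ∈ X, (∃ w ∈ A a, G.Adj v w) → (∀ w ∈ A b, ¬ G.Adj v w) →
        g v b ∈ A a → (g v b = lowNbr G ρ (A a) v ∨ ρ (g v b) < ρ (lowNbr G ρ (A a) v)) →
        False := by
      intro a ha b hb h3 h4 h5 h6
      rcases h6 with h6 | h6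
      · exact hM.ne b hb h4 a ha h3 h6
      · exact absurd ((lowNbr_spec h3).2.2 _ h5 (hM.adj b hb h4)) (not_le.2 h6)
    rcases h1 with ⟨h3, h4, h5⟩ | ⟨h3, rfl | h4⟩
    · rcases h2 with ⟨h6, h7, -⟩ | ⟨h6, rfl | h7⟩
      · exact hdisj z h4 h7
      · exact hmix _ hx _ hy h3 h6 h4 h5
      · exact hdisj z h4 h7
    · rcases h2 with ⟨h6, h7, h8⟩ | ⟨h6, h7 | h7⟩
      · exact hmix _ hy _ hx h6 h3 h7 h8
      · exact hne (hM.inj _ hx _ hy h3 h6 h7)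
      · exact h6 _ h7 (hM.adj _ hx h3)
    · rcases h2 with ⟨h6, h7, h8⟩ | ⟨h6, rfl | h7⟩
      · exact hdisj z h4 h7
      · exact h3 _ h4 (hM.adj _ hy h6)
      · exact hdisj z h4 h7
  refine ⟨T, fun i j hij => ?_, hind⟩
  -- If two trees coincided, the path from r to v₀ would be internally disjoint from itself, hence a
  -- single edge, but v₀ is not adjacent to r.
  by_contra hne
  obtain ⟨W, hW⟩ := (hind.isTree i).existsUnique_path r v₀
  let W' : (T j).Walk r v₀ := W.copy rfl rfl |>.transfer (T j) (fun e he => by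
    rw [← hij]; exact W.edges_subset_edgeSet (by simpa using he))
  have hW' : W'.IsPath := SimpleGraph.Walk.IsPath.transfer _ (by simpa using hW.1)
  have hsame : ∀ x ∈ W.support, x = r ∨ x = v₀ := fun x hx =>
    hind.internally_disjoint i j hne v₀ W W' hW.1 hW' x hx (by simpa [W'] using hx)
  have hadj : (T i).Adj r v₀ := by
    cases W with
    | nil => exact absurd rfl hv₀
    | cons h q =>
      rename_i w
      rcases hsame w (by simp) with rfl | rfl
      · exact absurd h ((T i).loopless.irrefl _)
      · exact h
  exact hv₀r (hind.le i hadj)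

/-! ### Minimum degree and connectivity -/

lemma minDeg_le_card_nb {V : Type*} [Fintype V] (G : SimpleGraph V) (v : V) :
    minDeg G ≤ (nb G v).card := by
  classical
  let _ : DecidableRel G.Adj := Classical.decRel G.Adj
  refine (G.minDegree_le_degree v).trans (le_of_eq ?_)
  rw [← SimpleGraph.card_neighborFinset_eq_degree]
  congr 1
  ext w
  simp

lemma exists_card_nb_eq_minDeg {V : Type*} [Fintype V] [Nonempty V] (G : SimpleGraph V) :
    ∃ v, (nb G v).card = minDeg G := by
  classical
  let _ : DecidableRel G.Adj := Classical.decRel G.Adj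
  obtain ⟨v, hv⟩ := G.exists_minimal_degree_vertex
  refine ⟨v, ?_⟩
  rw [minDeg, hv, ← SimpleGraph.card_neighborFinset_eq_degree]
  congr 1
  ext w
  simp

lemma card_nb_lt {V : Type*} [Fintype V] (G : SimpleGraph V) (v : V) :
    (nb G v).card < Fintype.card V :=
  Finset.card_lt_univ_of_notMem (x := v) (by simp)

/-- Deleting the neighbourhood of a vertex of minimum degree isolates it, while another vertex
remains because k < |V|. -/
lemma IsVertexConnected.le_minDeg {V : Type*} [Fintype V] [Nonempty V] {G : SimpleGraph V} {k : ℕ}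
    (h : IsVertexConnected G k) : k ≤ minDeg G := by
  classical
  obtain ⟨v, hv⟩ := exists_card_nb_eq_minDeg G
  by_contra! hk
  have hconn := h.2 (nb G v) (by omega)
  have hcard : (insert v (nb G v)).card < Fintype.card V := by
    have := Finset.card_insert_le v (nb G v)
    have := h.1
    omega
  obtain ⟨w, hw⟩ : ∃ w, w ∉ insert v (nb G v) := by
    by_contra! hall
    rw [Finset.eq_univ_of_forall hall, Finset.card_univ] at hcard
    exact lt_irrefl _ hcard
  simp only [Finset.mem_insert, not_or] at hw
  let v' : {x : V | x ∉ nb G v} := ⟨v, by simp⟩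
  let w' : {x : V | x ∉ nb G v} := ⟨w, hw.2⟩
  obtain ⟨W⟩ := hconn.preconnected v' w'
  have hadj := W.adj_snd fun hnil => hw.1 (congrArg Subtype.val hnil.eq).symm
  exact W.snd.2 (by simpa [v'] using hadj)

/-- Root the trees at a surviving vertex u. The k paths to v are internally disjoint, so fewer than
k deleted vertices leave one of them intact. -/
lemma isVertexConnected_of_hasISTs {V : Type*} [Fintype V] {G : SimpleGraph V} {k : ℕ}
    (hk : k < Fintype.card V) (h : ∀ r, HasISTs G r k) : IsVertexConnected G k := by
  classical
  refine ⟨hk, fun X hX => ?_⟩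
  have hne : Nonempty {v : V | v ∉ X} := by
    by_contra hemp
    have hall : ∀ v, v ∈ X := fun v => by
      by_contra hv
      exact hemp ⟨⟨v, hv⟩⟩
    rw [Finset.eq_univ_of_forall hall, Finset.card_univ] at hX
    omega
  refine SimpleGraph.Connected.mk fun u v => ?_
  obtain ⟨T, -, hT⟩ := h u
  have hpath : ∀ i, ∃ P : (T i).Walk u v, P.IsPath := fun i =>
    ((hT.isTree i).existsUnique_path u v).exists
  choose P hP using hpath
  obtain ⟨i, hi⟩ : ∃ i, ∀ x ∈ (P i).support, x ∉ X := by
    by_contra! hbad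
    choose b hb hbX using hbad
    have hinj : Function.Injective b := by
      intro i j hij
      by_contra hne
      rcases hT.internally_disjoint i j hne v (P i) (P j) (hP i) (hP j) (b i) (hb i)
        (hij ▸ hb j) with h1 | h1
      · exact u.2 (h1 ▸ hbX i)
      · exact v.2 (h1 ▸ hbX i)
    have := Finset.card_le_card_of_injOn (s := Finset.univ) (t := X) b (fun i _ => hbX i)
      hinj.injOn
    simp at this
    omega
  exact ⟨((P i).mapLe (hT.le i)).induce {v : V | v ∉ X} (by simpa using hi)⟩

theorem connectivity_eq_minDeg {V : Type*} [Fintype V] [Nonempty V] {G : SimpleGraph V}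
    (h : ∀ r, HasISTs G r (minDeg G)) : connectivity G = minDeg G := by
  have hk : minDeg G < Fintype.card V := by
    obtain ⟨v, hv⟩ := exists_card_nb_eq_minDeg G
    exact hv ▸ card_nb_lt G v
  have hmem := isVertexConnected_of_hasISTs hk h
  refine le_antisymm (csSup_le ⟨_, hmem⟩ fun k hk => hk.le_minDeg) ?_
  exact le_csSup ⟨minDeg G, fun k hk => hk.le_minDeg⟩ hmem

/-! ### Exposing edges adaptively -/

/-- Partition the subsets S of E by their exposed part S \ Q S. On one fibre Q is a constant D, and
S ∩ D runs over all subsets of D with the product weights. The binomial theorem therefore gives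
conditional expectation (1 - p + p t)^|D| for t^|S ∩ D|, and this is at most K on the fibres
retained by P. -/
lemma sum_powerset_adaptive_le {α : Type*} [DecidableEq α] (E : Finset α) (Q : Finset α → Finset α)
    (hQE : ∀ S ⊆ E, Q S ⊆ E)
    (hinv : ∀ S ⊆ E, ∀ S' ⊆ E, S \ Q S = S' \ Q S → Q S' = Q S)
    {p t K : ℝ} (hp0 : 0 ≤ p) (hp1 : p ≤ 1) (hK : 0 ≤ K)
    (P : Finset α → Prop) [DecidablePred P]
    (hP : ∀ S, P S → (1 - p + p * t) ^ S.card ≤ K) :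
    ∑ S ∈ E.powerset with P (Q S), p ^ S.card * (1 - p) ^ (E.card - S.card) * t ^ (S ∩ Q S).card
      ≤ K := by
  set F := E.powerset.filter fun S => P (Q S) with hF
  set w : Finset α → ℝ := fun S => p ^ S.card * (1 - p) ^ (E.card - S.card) with hw
  have hw0 : ∀ S, 0 ≤ w S := fun S =>
    mul_nonneg (pow_nonneg hp0 _) (pow_nonneg (by linarith) _)
  set h : Finset α → Finset α := fun S => S \ Q S with hh
  have htot : ∑ S ∈ F, w S ≤ 1 := by
    calc ∑ S ∈ F, w S ≤ ∑ S ∈ E.powerset, w S :=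
          Finset.sum_le_sum_of_subset_of_nonneg (Finset.filter_subset _ _) fun S _ _ => hw0 S
      _ = (p + (1 - p)) ^ E.card := Finset.sum_pow_mul_eq_add_pow _ _ _
      _ = 1 := by norm_num
  have hmaps : ∀ S ∈ F, h S ∈ F.image h := fun S hS => Finset.mem_image_of_mem _ hS
  suffices H : ∀ H ∈ F.image h, ∑ S ∈ F with h S = H, w S * t ^ (S ∩ Q S).card ≤
      K * ∑ S ∈ F with h S = H, w S by
    calc ∑ S ∈ F, w S * t ^ (S ∩ Q S).card
        = ∑ H ∈ F.image h, ∑ S ∈ F with h S = H, w S * t ^ (S ∩ Q S).card :=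
          (Finset.sum_fiberwise_of_maps_to hmaps _).symm
      _ ≤ ∑ H ∈ F.image h, K * ∑ S ∈ F with h S = H, w S := Finset.sum_le_sum H
      _ = K * ∑ S ∈ F, w S := by
          rw [← Finset.mul_sum, Finset.sum_fiberwise_of_maps_to hmaps]
      _ ≤ K := mul_le_of_le_one_right hK htot
  intro H hH
  obtain ⟨S₀, hS₀, rfl⟩ := Finset.mem_image.1 hH
  rw [hF, Finset.mem_filter, Finset.mem_powerset] at hS₀
  obtain ⟨hS₀E, hS₀P⟩ := hS₀
  set D := Q S₀ with hD
  set B := h S₀ with hB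
  have hBD : Disjoint B D := Finset.sdiff_disjoint
  have hDE : D ⊆ E := hQE _ hS₀E
  have hBE : B ⊆ E := Finset.sdiff_subset.trans hS₀E
  -- The exposed part B is the reference configuration of its fibre: by invariance both Q S and Q S₀
  -- equal Q B.
  have hQof : ∀ S ⊆ E, h S = B → Q S = D := by
    intro S hS hSB
    have h1 : Q B = Q S := by
      refine hinv S hS B hBE ?_
      have : B = S \ Q S := hSB.symm
      rw [this, Finset.sdiff_idem]
    have h2 : Q B = D := by
      refine hinv S₀ hS₀E B hBE ?_
      change B = B \ D
      exact (Finset.sdiff_eq_self_of_disjoint hBD).symm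
    rw [← h1, h2]
  have hfib : (F.filter fun S => h S = B) = D.powerset.image fun R => B ∪ R := by
    ext S
    simp only [Finset.mem_filter, Finset.mem_image, Finset.mem_powerset, hF]
    constructor
    · rintro ⟨⟨hS, -⟩, hSB⟩
      have hQ := hQof S hS hSB
      refine ⟨S ∩ D, Finset.inter_subset_right, ?_⟩
      rw [← hSB, hh]
      simp only [hQ]
      exact Finset.sdiff_union_inter S D
    · rintro ⟨R, hR, rfl⟩
      have hS : B ∪ R ⊆ E := Finset.union_subset hBE (hR.trans hDE)
      have hsd : (B ∪ R) \ D = B := by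
        rw [Finset.union_sdiff_distrib, Finset.sdiff_eq_empty_iff_subset.2 hR, Finset.union_empty,
          Finset.sdiff_eq_self_of_disjoint hBD]
      have hQ : Q (B ∪ R) = D := by
        refine hinv S₀ hS₀E _ hS ?_
        change B = _
        exact hsd.symm
      refine ⟨⟨hS, by rw [hQ]; exact hS₀P⟩, ?_⟩
      simp only [hh, hQ, hsd]
  have hinjOn : Set.InjOn (fun R => B ∪ R) (D.powerset : Set (Finset α)) := by
    intro R hR R' hR' heq
    simp only [Finset.coe_powerset, Set.mem_preimage, Set.mem_powerset_iff, Finset.coe_subset]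
      at hR hR'
    have e1 : ∀ R ⊆ D, (B ∪ R) ∩ D = R := fun R hR => by
      rw [Finset.union_inter_distrib_right, Finset.disjoint_iff_inter_eq_empty.1 hBD,
        Finset.empty_union, Finset.inter_eq_left.2 hR]
    rw [← e1 R hR, ← e1 R' hR']
    exact congrArg (· ∩ D) heq
  have hval : ∀ R ∈ D.powerset, w (B ∪ R) =
      (p ^ B.card * (1 - p) ^ (E.card - B.card - D.card)) *
        (p ^ R.card * (1 - p) ^ (D.card - R.card)) := by
    intro R hR
    rw [Finset.mem_powerset] at hR
    have hc : (B ∪ R).card = B.card + R.card :=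
      Finset.card_union_of_disjoint (Finset.disjoint_of_subset_right hR hBD)
    have hBDc : B.card + D.card ≤ E.card := by
      rw [← Finset.card_union_of_disjoint hBD]
      exact Finset.card_le_card (Finset.union_subset hBE hDE)
    have hRD := Finset.card_le_card hR
    have he : E.card - (B.card + R.card) = (E.card - B.card - D.card) + (D.card - R.card) := by
      omega
    simp only [hw, hc, he, pow_add]
    ring
  have hcard : ∀ R ∈ D.powerset, ((B ∪ R) ∩ Q (B ∪ R)).card = R.card := by
    intro R hR
    have hmem : B ∪ R ∈ F.filter fun S => h S = B := by
      rw [hfib]; exact Finset.mem_image_of_mem _ hR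
    rw [Finset.mem_filter, hF, Finset.mem_filter, Finset.mem_powerset] at hmem
    rw [hQof _ hmem.1.1 hmem.2, Finset.union_inter_distrib_right,
      Finset.disjoint_iff_inter_eq_empty.1 hBD, Finset.empty_union,
      Finset.inter_eq_left.2 (Finset.mem_powerset.1 hR)]
  rw [hfib, Finset.sum_image hinjOn, Finset.sum_image hinjOn]
  have s1 : ∑ R ∈ D.powerset, w (B ∪ R) * t ^ ((B ∪ R) ∩ Q (B ∪ R)).card =
      (p ^ B.card * (1 - p) ^ (E.card - B.card - D.card)) * (p * t + (1 - p)) ^ D.card := by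
    rw [← Finset.sum_pow_mul_eq_add_pow, Finset.mul_sum]
    refine Finset.sum_congr rfl fun R hR => ?_
    rw [hval R hR, hcard R hR, mul_pow]
    ring
  have s2 : ∑ R ∈ D.powerset, w (B ∪ R) =
      (p ^ B.card * (1 - p) ^ (E.card - B.card - D.card)) * (p + (1 - p)) ^ D.card := by
    rw [← Finset.sum_pow_mul_eq_add_pow, Finset.mul_sum]
    exact Finset.sum_congr rfl hval
  rw [s1, s2]
  have h3 := hP D hS₀P
  have h4 : 0 ≤ p ^ B.card * (1 - p) ^ (E.card - B.card - D.card) :=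
    mul_nonneg (pow_nonneg hp0 _) (pow_nonneg (by linarith) _)
  calc _ = (p ^ B.card * (1 - p) ^ (E.card - B.card - D.card)) * (1 - p + p * t) ^ D.card := by
        ring_nf
    _ ≤ (p ^ B.card * (1 - p) ^ (E.card - B.card - D.card)) * K :=
        mul_le_mul_of_nonneg_left h3 h4
    _ = _ := by norm_num; ring

open Classical in
/-- The edges of `G`, as a finite set. -/
noncomputable def edges {V : Type*} [Fintype V] (G : SimpleGraph V) : Finset (Sym2 V) :=
  Finset.univ.filter (· ∈ G.edgeSet)

@[simp] lemma mem_edges {V : Type*} [Fintype V] {G : SimpleGraph V} {e : Sym2 V} :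
    e ∈ edges G ↔ e ∈ G.edgeSet := by
  simp [edges]

/-- The random set `Q G` of pairs is *free*: changing `G` on the pairs in `Q G` does not
change `Q G`. -/
structure IsFree {V : Type*} (Q : SimpleGraph V → Finset (Sym2 V)) : Prop where
  not_isDiag : ∀ G, ∀ e ∈ Q G, ¬ e.IsDiag
  inv : ∀ G G', (∀ e ∉ Q G, e ∈ G.edgeSet ↔ e ∈ G'.edgeSet) → Q G' = Q G

open Classical in
lemma binomialRandom_real_eq_sum {V : Type*} [Fintype V] (p : I) (𝒜 : Set (SimpleGraph V)) :
    G(V, p).real 𝒜 = ∑ G : SimpleGraph V with G ∈ 𝒜,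
      (p : ℝ) ^ (edges G).card * (1 - p : ℝ) ^ ((Fintype.card V).choose 2 - (edges G).card) := by
  have h1 : 𝒜 = ((Finset.univ.filter (· ∈ 𝒜) : Finset (SimpleGraph V)) : Set (SimpleGraph V)) := by
    ext; simp
  have : MeasurableSingletonClass (SimpleGraph V) := ⟨fun G => by
    have : ({G} : Set (SimpleGraph V)) = SimpleGraph.edgeSet ⁻¹' {G.edgeSet} := by
      ext; simp
    rw [this]
    exact SimpleGraph.measurableEmbedding_edgeSet.measurable (measurableSet_singleton _)⟩
  conv_lhs => rw [h1]
  rw [← MeasureTheory.sum_measureReal_singleton]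
  refine Finset.sum_congr rfl fun G _ => ?_
  rw [MeasureTheory.measureReal_def, SimpleGraph.binomialRandom_singleton]
  have : G.edgeSet.ncard = (edges G).card := by
    rw [← Set.ncard_coe_finset]
    congr 1
    ext; simp
  simp [this]

-- Markov's inequality for t^|edges G ∩ Q G|: the number of edges in a free set behaves as if the
-- set had been fixed in advance.
open Classical in
theorem IsFree.prob_le {V : Type*} [Fintype V] {Q : SimpleGraph V → Finset (Sym2 V)}
    (hQ : IsFree Q) (p : I) {t K c : ℝ} (ht : 0 ≤ t) (hK : 0 ≤ K) (hc : 0 < c)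
    {𝒜 : Set (SimpleGraph V)}
    (h𝒜 : ∀ G ∈ 𝒜, (1 - p + p * t : ℝ) ^ (Q G).card ≤ K ∧ c ≤ t ^ (edges G ∩ Q G).card) :
    G(V, p).real 𝒜 ≤ K / c := by
  set E : Finset (Sym2 V) := Finset.univ.filter fun e => ¬ e.IsDiag with hE
  have hEcard : E.card = (Fintype.card V).choose 2 := by
    rw [← Sym2.card_diagSet_compl, ← Set.toFinset_card]
    congr 1
    ext e
    simp [hE]
  have hfrom : ∀ S ⊆ E, edges (SimpleGraph.fromEdgeSet (S : Set (Sym2 V))) = S := by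
    intro S hS
    ext e
    have := @hS e
    simp only [hE, Finset.mem_filter, Finset.mem_univ, true_and] at this
    simp only [mem_edges, SimpleGraph.edgeSet_fromEdgeSet, Set.mem_sdiff, Finset.mem_coe]
    exact ⟨fun h => h.1, fun h => ⟨h, by simpa using this h⟩⟩
  have hto : ∀ G : SimpleGraph V, SimpleGraph.fromEdgeSet (edges G : Set (Sym2 V)) = G := by
    intro G
    have : (edges G : Set (Sym2 V)) = G.edgeSet := by ext; simp
    rw [this, SimpleGraph.fromEdgeSet_edgeSet]
  have hedgesE : ∀ G : SimpleGraph V, edges G ⊆ E := fun G e he => by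
    simp only [hE, Finset.mem_filter, Finset.mem_univ, true_and]
    exact G.not_isDiag_of_mem_edgeSet (by simpa using he)
  have hp0 : (0 : ℝ) ≤ p := p.2.1
  have hp1 : (p : ℝ) ≤ 1 := p.2.2
  have hmain := sum_powerset_adaptive_le E (fun S => Q (SimpleGraph.fromEdgeSet (S : Set (Sym2 V))))
    (fun S _ e he => by simpa [hE] using hQ.not_isDiag _ e he)
    (fun S hS S' hS' heq => by
      refine hQ.inv _ _ fun e he => ?_
      rw [← mem_edges, ← mem_edges, hfrom S hS, hfrom S' hS']
      have := Finset.ext_iff.1 heq e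
      simpa [he] using this) (t := t) hp0 hp1 hK
    (fun D => (1 - p + p * t : ℝ) ^ D.card ≤ K) (fun _ h => h)
  rw [le_div_iff₀ hc, binomialRandom_real_eq_sum, Finset.sum_mul]
  refine le_trans ?_ hmain
  set f : Finset (Sym2 V) → ℝ := fun S => (p : ℝ) ^ S.card * (1 - p : ℝ) ^ (E.card - S.card) *
    t ^ (S ∩ Q (SimpleGraph.fromEdgeSet (S : Set (Sym2 V)))).card with hf
  have hf0 : ∀ S, 0 ≤ f S := fun S => mul_nonneg
    (mul_nonneg (pow_nonneg hp0 _) (pow_nonneg (by linarith) _)) (pow_nonneg ht _)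
  have hinj : Function.Injective (edges : SimpleGraph V → Finset (Sym2 V)) := fun G G' h => by
    rw [← hto G, ← hto G', h]
  calc _ ≤ ∑ G : SimpleGraph V with G ∈ 𝒜, f (edges G) := by
        refine Finset.sum_le_sum fun G hG => ?_
        simp only [hf, hto, hEcard]
        refine mul_le_mul_of_nonneg_left ?_
          (mul_nonneg (pow_nonneg hp0 _) (pow_nonneg (by linarith) _))
        exact (h𝒜 G (by simpa using hG)).2
    _ = ∑ S ∈ (Finset.univ.filter fun G : SimpleGraph V => G ∈ 𝒜).image edges, f S :=
        (Finset.sum_image hinj.injOn).symm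
    _ ≤ _ := by
        refine Finset.sum_le_sum_of_subset_of_nonneg ?_ fun S _ _ => hf0 S
        intro S hS
        obtain ⟨G, hG, rfl⟩ := Finset.mem_image.1 hS
        simp only [Finset.mem_filter, Finset.mem_powerset, hto]
        exact ⟨hedgesE G, (h𝒜 G (by simpa using hG)).1⟩

/-- The case t = 0, where the moment counts only graphs without an edge in the free set. -/
theorem IsFree.prob_avoid_le {V : Type*} [Fintype V] {Q : SimpleGraph V → Finset (Sym2 V)}
    (hQ : IsFree Q) (p : I) {q : ℝ} {𝒜 : Set (SimpleGraph V)}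
    (h𝒜 : ∀ G ∈ 𝒜, q ≤ (Q G).card ∧ ∀ e ∈ Q G, e ∉ G.edgeSet) :
    G(V, p).real 𝒜 ≤ Real.exp (-(p * q)) := by
  classical
  have hp0 : (0 : ℝ) ≤ p := p.2.1
  have hp1 : (p : ℝ) ≤ 1 := p.2.2
  have := hQ.prob_le p (t := 0) (K := Real.exp (-(p * q))) (c := 1) le_rfl (Real.exp_pos _).le
    one_pos (𝒜 := 𝒜) fun G hG => by
      obtain ⟨h1, h2⟩ := h𝒜 G hG
      have h3 : edges G ∩ Q G = ∅ := by
        ext e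
        simp only [Finset.mem_inter, mem_edges, Finset.notMem_empty, iff_false, not_and]
        exact fun h h' => h2 e h' h
      constructor
      · calc (1 - p + p * 0 : ℝ) ^ (Q G).card ≤ Real.exp (-p) ^ (Q G).card := by
              refine pow_le_pow_left₀ (by linarith) ?_ _
              have := Real.add_one_le_exp (-(p : ℝ))
              linarith
          _ = Real.exp ((Q G).card * (-p)) := (Real.exp_nat_mul _ _).symm
          _ ≤ _ := Real.exp_le_exp.2 (by nlinarith)
      · simp [h3]
  simpa using this

theorem IsFree.prob_upper_le {V : Type*} [Fintype V] [DecidableEq V]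
    {Q : SimpleGraph V → Finset (Sym2 V)}
    (hQ : IsFree Q) (p : I) {ε u : ℝ} (hε0 : 0 < ε) (hε1 : ε ≤ 1) (hu : 0 ≤ u)
    {𝒜 : Set (SimpleGraph V)}
    (h𝒜 : ∀ G ∈ 𝒜, (p : ℝ) * (Q G).card ≤ u ∧ (1 + ε) * u ≤ (edges G ∩ Q G).card) :
    G(V, p).real 𝒜 ≤ Real.exp (-(ε ^ 2 * u / 8)) := by
  have hp0 : (0 : ℝ) ≤ p := p.2.1
  have hp1 : (p : ℝ) ≤ 1 := p.2.2
  have hlog : ε / 4 - (ε / 4) ^ 2 ≤ Real.log (1 + ε / 4) := by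
    have h1 := Real.one_sub_inv_le_log_of_pos (show (0 : ℝ) < 1 + ε / 4 by positivity)
    refine le_trans ?_ h1
    rw [le_sub_iff_add_le, ← le_sub_iff_add_le', inv_le_iff_one_le_mul₀ (by positivity)]
    nlinarith [pow_pos hε0 3]
  -- A rational t near 1 replaces the optimal Chernoff parameter; it already gives the exponent
  -- ε²u/8.
  have := hQ.prob_le p (t := 1 + ε / 4) (K := Real.exp (u * (ε / 4)))
    (c := Real.exp (Real.log (1 + ε / 4) * ((1 + ε) * u))) (by positivity) (Real.exp_pos _).le
    (Real.exp_pos _) (𝒜 := 𝒜) fun G hG => by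
      obtain ⟨h1, h2⟩ := h𝒜 G hG
      constructor
      · calc (1 - p + p * (1 + ε / 4) : ℝ) ^ (Q G).card ≤ Real.exp (p * (ε / 4)) ^ (Q G).card := by
              refine pow_le_pow_left₀ (by nlinarith) ?_ _
              have := Real.add_one_le_exp (p * (ε / 4) : ℝ)
              linarith
          _ = Real.exp ((Q G).card * (p * (ε / 4))) := (Real.exp_nat_mul _ _).symm
          _ ≤ _ := Real.exp_le_exp.2 (by nlinarith)
      · calc Real.exp (Real.log (1 + ε / 4) * ((1 + ε) * u))
            ≤ Real.exp (Real.log (1 + ε / 4) * (edges G ∩ Q G).card) := by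
              refine Real.exp_le_exp.2 (mul_le_mul_of_nonneg_left h2 (Real.log_nonneg ?_))
              linarith
          _ = (1 + ε / 4) ^ (edges G ∩ Q G).card := by
              rw [mul_comm, Real.exp_nat_mul, Real.exp_log (by positivity)]
          _ ≤ _ := le_of_eq (by congr!)
  refine this.trans ?_
  rw [← Real.exp_sub, Real.exp_le_exp]
  have h3 : (ε / 4 - (ε / 4) ^ 2) * ((1 + ε) * u) ≤ Real.log (1 + ε / 4) * ((1 + ε) * u) :=
    mul_le_mul_of_nonneg_right hlog (by positivity)
  have h4 : 0 ≤ u * ε ^ 2 * (1 - ε) := mul_nonneg (by positivity) (by linarith)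
  nlinarith

theorem IsFree.prob_lower_le {V : Type*} [Fintype V] [DecidableEq V]
    {Q : SimpleGraph V → Finset (Sym2 V)}
    (hQ : IsFree Q) (p : I) {ε u : ℝ} (hε0 : 0 < ε) (hε1 : ε ≤ 1) (hu : 0 ≤ u)
    {𝒜 : Set (SimpleGraph V)}
    (h𝒜 : ∀ G ∈ 𝒜, u ≤ (p : ℝ) * (Q G).card ∧ (edges G ∩ Q G).card ≤ (1 - ε) * u) :
    G(V, p).real 𝒜 ≤ Real.exp (-(ε ^ 2 * u / 8)) := by
  have hp0 : (0 : ℝ) ≤ p := p.2.1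
  have hp1 : (p : ℝ) ≤ 1 := p.2.2
  set t : ℝ := 1 - ε / 2 with ht
  have ht0 : 1 / 2 ≤ t := by linarith
  have ht1 : t ≤ 1 := by linarith
  have := hQ.prob_le p (t := t) (K := Real.exp (-(u * (ε / 2))))
    (c := Real.exp (Real.log t * ((1 - ε) * u))) (by positivity) (Real.exp_pos _).le
    (Real.exp_pos _) (𝒜 := 𝒜) fun G hG => by
      obtain ⟨h1, h2⟩ := h𝒜 G hG
      constructor
      · calc (1 - p + p * t : ℝ) ^ (Q G).card ≤ Real.exp (-(p * (ε / 2))) ^ (Q G).card := by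
              refine pow_le_pow_left₀ (by nlinarith) ?_ _
              have := Real.add_one_le_exp (-(p * (ε / 2)) : ℝ)
              rw [ht]; linarith
          _ = Real.exp ((Q G).card * (-(p * (ε / 2)))) := (Real.exp_nat_mul _ _).symm
          _ ≤ _ := Real.exp_le_exp.2 (by nlinarith)
      · calc Real.exp (Real.log t * ((1 - ε) * u))
            ≤ Real.exp (Real.log t * (edges G ∩ Q G).card) := by
              refine Real.exp_le_exp.2 (mul_le_mul_of_nonpos_left h2 (Real.log_nonpos ?_ ht1))
              linarith
          _ = t ^ (edges G ∩ Q G).card := by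
              rw [mul_comm, Real.exp_nat_mul, Real.exp_log (by linarith)]
          _ ≤ _ := le_of_eq (by congr!)
  refine this.trans ?_
  rw [← Real.exp_sub, Real.exp_le_exp]
  have hlog : -(ε / 2 + ε ^ 2 / 4 + ε ^ 3 / 4) ≤ Real.log t := by
    have h1 := Real.one_sub_inv_le_log_of_pos (show (0 : ℝ) < t by linarith)
    refine le_trans ?_ h1
    rw [le_sub_iff_add_le, ← le_sub_iff_add_le', inv_le_iff_one_le_mul₀ (by linarith)]
    rw [ht]
    nlinarith [mul_nonneg (pow_nonneg hε0.le 3) (sub_nonneg.2 hε1)]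
  have h3 : -(ε / 2 + ε ^ 2 / 4 + ε ^ 3 / 4) * ((1 - ε) * u) ≤ Real.log t * ((1 - ε) * u) :=
    mul_le_mul_of_nonneg_right hlog (mul_nonneg (by linarith) hu)
  nlinarith [mul_nonneg (sq_nonneg ε) hu, mul_nonneg (pow_nonneg hε0.le 4) hu]

/-! ### Union bounds -/

-- Summing n^(-|P|) over all vertex sets P gives (1 + 1/n)^n ≤ 3, so all pairs (P, R) cost at most a
-- factor 9.
open MeasureTheory in
lemma measureReal_exists_pair_le {Ω V : Type*} [MeasurableSpace Ω] (μ : Measure Ω)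
    [IsFiniteMeasure μ] [Fintype V] [Nonempty V] (E : Finset V → Finset V → Set Ω)
    (hE : ∀ P R : Finset V, P.Nonempty → R.card ≤ P.card →
      μ.real (E P R) ≤ Real.exp (-(10 * Real.log (Fintype.card V) * P.card))) :
    μ.real {ω | ∃ P R : Finset V, P.Nonempty ∧ R.card ≤ P.card ∧ ω ∈ E P R} ≤
      9 * ((Fintype.card V : ℝ)⁻¹) ^ 8 := by
  classical
  set n : ℝ := (Fintype.card V : ℝ) with hn
  have hn1 : 1 ≤ n := by
    rw [hn]; exact_mod_cast Fintype.card_pos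
  have hn0 : 0 < n := by linarith
  have hx1 : n⁻¹ ≤ 1 := inv_le_one_of_one_le₀ hn1
  have hx0 : 0 ≤ n⁻¹ := by positivity
  let E' : Finset V × Finset V → Set Ω := fun x =>
    if x.1.Nonempty ∧ x.2.card ≤ x.1.card then E x.1 x.2 else ∅
  have hE' : ∀ x, μ.real (E' x) ≤ (n⁻¹) ^ 8 * ((n⁻¹) ^ x.1.card * (n⁻¹) ^ x.2.card) := by
    intro x
    by_cases h : x.1.Nonempty ∧ x.2.card ≤ x.1.card
    · simp only [E', if_pos h]
      refine (hE _ _ h.1 h.2).trans ?_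
      have h1 : Real.exp (-(10 * Real.log n * x.1.card)) = (n⁻¹) ^ (10 * x.1.card) := by
        rw [show -(10 * Real.log n * x.1.card) = ((10 * x.1.card : ℕ) : ℝ) * (-Real.log n) by
          push_cast; ring, Real.exp_nat_mul, Real.exp_neg, Real.exp_log hn0]
      -- As |R| ≤ |P| and |P| ≥ 1, the exponent 10|P| is at least 8 + |P| + |R|.
      rw [h1, ← pow_add, ← pow_add]
      have := h.1.card_pos
      exact pow_le_pow_of_le_one hx0 hx1 (by omega)
    · simp only [E', if_neg h, measureReal_empty]
      positivity
  have hsub : {ω | ∃ P R : Finset V, P.Nonempty ∧ R.card ≤ P.card ∧ ω ∈ E P R} ⊆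
      ⋃ x ∈ (Finset.univ : Finset (Finset V × Finset V)), E' x := by
    rintro ω ⟨P, R, hP, hR, hω⟩
    simp only [Set.mem_iUnion]
    exact ⟨(P, R), Finset.mem_univ _, by simpa [E', hP, hR] using hω⟩
  have hsum : ∑ P : Finset V, (n⁻¹) ^ P.card ≤ 3 := by
    have h1 : ∑ P : Finset V, (n⁻¹) ^ P.card = (n⁻¹ + 1) ^ Fintype.card V := by
      rw [← Finset.card_univ, ← Finset.sum_pow_mul_eq_add_pow]
      simp
    rw [h1]
    calc (n⁻¹ + 1) ^ Fintype.card V ≤ Real.exp (n⁻¹) ^ Fintype.card V :=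
          pow_le_pow_left₀ (by positivity) (Real.add_one_le_exp _) _
      _ = Real.exp 1 := by
          rw [← Real.exp_nat_mul, mul_inv_cancel₀ (by positivity)]
      _ ≤ 3 := by linarith [Real.exp_one_lt_d9]
  calc μ.real {ω | ∃ P R : Finset V, P.Nonempty ∧ R.card ≤ P.card ∧ ω ∈ E P R}
      ≤ μ.real (⋃ x ∈ (Finset.univ : Finset (Finset V × Finset V)), E' x) :=
        measureReal_mono hsub (measure_ne_top _ _)
    _ ≤ ∑ x : Finset V × Finset V, μ.real (E' x) := measureReal_biUnion_finset_le _ _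
    _ ≤ ∑ x : Finset V × Finset V, (n⁻¹) ^ 8 * ((n⁻¹) ^ x.1.card * (n⁻¹) ^ x.2.card) :=
        Finset.sum_le_sum fun x _ => hE' x
    _ = (n⁻¹) ^ 8 * ((∑ P : Finset V, (n⁻¹) ^ P.card) * ∑ P : Finset V, (n⁻¹) ^ P.card) := by
        rw [← Finset.mul_sum, Finset.sum_mul_sum, Fintype.sum_prod_type]
    _ ≤ (n⁻¹) ^ 8 * (3 * 3) := by
        refine mul_le_mul_of_nonneg_left ?_ (by positivity)
        exact mul_le_mul hsum hsum (Finset.sum_nonneg fun _ _ => by positivity) (by norm_num)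
    _ = _ := by ring

open MeasureTheory in
lemma measureReal_exists_le {Ω V : Type*} [MeasurableSpace Ω] (μ : Measure Ω)
    [IsFiniteMeasure μ] [Fintype V] (E : V → Set Ω) {K : ℝ} (hE : ∀ v, μ.real (E v) ≤ K) :
    μ.real {ω | ∃ v, ω ∈ E v} ≤ Fintype.card V * K := by
  have hsub : {ω | ∃ v, ω ∈ E v} ⊆ ⋃ v ∈ (Finset.univ : Finset V), E v := by
    rintro ω ⟨v, hv⟩
    simp only [Set.mem_iUnion]
    exact ⟨v, Finset.mem_univ _, hv⟩
  calc μ.real {ω | ∃ v, ω ∈ E v} ≤ μ.real (⋃ v ∈ (Finset.univ : Finset V), E v) :=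
        measureReal_mono hsub (measure_ne_top _ _)
    _ ≤ ∑ v, μ.real (E v) := measureReal_biUnion_finset_le _ _
    _ ≤ ∑ _v : V, K := Finset.sum_le_sum fun v _ => hE v
    _ = _ := by simp

lemma isFree_const {V : Type*} {D : Finset (Sym2 V)} (hD : ∀ e ∈ D, ¬ e.IsDiag) :
    IsFree fun _ : SimpleGraph V => D :=
  ⟨fun _ => hD, fun _ _ _ => rfl⟩

/-! ### Linked graphs and disjoint connected segments -/

/-- Any two disjoint sets of `m` vertices are joined by an edge. -/
def IsLinked {V : Type*} (G : SimpleGraph V) (m : ℕ) : Prop :=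
  ∀ S T : Finset V, Disjoint S T → S.card = m → T.card = m → ∃ s ∈ S, ∃ t ∈ T, G.Adj s t

lemma card_image_sym2_mk {V : Type*} [DecidableEq V] {S T : Finset V} (h : Disjoint S T) :
    ((S ×ˢ T).image fun x => s(x.1, x.2)).card = S.card * T.card := by
  rw [Finset.card_image_of_injOn, Finset.card_product]
  rintro ⟨a, b⟩ hab ⟨c, d⟩ hcd heq
  simp only [Finset.coe_product, Set.mem_prod, Finset.mem_coe] at hab hcd
  simp only [Sym2.eq_iff] at heq
  rcases heq with ⟨rfl, rfl⟩ | ⟨rfl, rfl⟩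
  · rfl
  · exact absurd hcd.2 (Finset.disjoint_left.1 h hab.1)

lemma prob_not_isLinked_le {V : Type*} [Fintype V] [Nonempty V] (p : I) {m : ℕ} (hm0 : 0 < m)
    (hm : 10 * Real.log (Fintype.card V) ≤ p * m) :
    G(V, p).real {G | ¬ IsLinked G m} ≤ 9 * ((Fintype.card V : ℝ)⁻¹) ^ 8 := by
  classical
  refine le_trans ?_ (measureReal_exists_pair_le G(V, p) (V := V) (fun S T =>
    {G | Disjoint S T ∧ S.card = m ∧ T.card = m ∧ ∀ s ∈ S, ∀ t ∈ T, ¬ G.Adj s t}) ?_)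
  · refine MeasureTheory.measureReal_mono fun G hG => ?_
    simp only [IsLinked, Set.mem_ofPred_eq] at hG
    push Not at hG
    obtain ⟨S, T, hST, hS, hT, h⟩ := hG
    exact ⟨S, T, Finset.card_pos.1 (by omega), by omega, hST, hS, hT, h⟩
  · intro S T _ _
    by_cases hST : Disjoint S T ∧ S.card = m ∧ T.card = m
    · obtain ⟨hST, hS, hT⟩ := hST
      have hfree : IsFree fun _ : SimpleGraph V => (S ×ˢ T).image fun x => s(x.1, x.2) := by
        refine isFree_const ?_
        intro e he
        obtain ⟨⟨s, t⟩, hst, rfl⟩ := Finset.mem_image.1 he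
        rw [Finset.mem_product] at hst
        rw [Sym2.mk_isDiag_iff]
        intro h
        exact Finset.disjoint_left.1 hST hst.1 (h ▸ hst.2)
      refine (hfree.prob_avoid_le p (q := m * m) ?_).trans (Real.exp_le_exp.2 ?_)
      · rintro G ⟨-, -, -, hG⟩
        refine ⟨by rw [card_image_sym2_mk hST, hS, hT]; push_cast; rfl, fun e he => ?_⟩
        obtain ⟨⟨s, t⟩, hst, rfl⟩ := Finset.mem_image.1 he
        rw [Finset.mem_product] at hst
        exact hG s hst.1 t hst.2
      · rw [hS]
        have : (0 : ℝ) ≤ m := by positivity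
        nlinarith
    · have : {G : SimpleGraph V | Disjoint S T ∧ S.card = m ∧ T.card = m ∧
          ∀ s ∈ S, ∀ t ∈ T, ¬ G.Adj s t} = ∅ := by
        ext G
        simp only [Set.mem_ofPred_eq, Set.mem_empty_iff_false, iff_false]
        tauto
      rw [this, MeasureTheory.measureReal_empty]
      exact (Real.exp_pos _).le

/-- Take a smallest Z ⊆ R with at least m vertices and no edge to R \ Z. If its largest connected
subset B of at most a vertices had fewer than a, then B would be closed in Z, and minimality would
give |Z \ B| < m. Then |Z| < 2m, so R \ Z has at least m vertices and linkedness yields an edge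
leaving Z. -/
lemma IsLinked.exists_connected {V : Type*} {G : SimpleGraph V} {m : ℕ}
    (hG : IsLinked G m) {R : Finset V} (hR : 3 * m ≤ R.card) {a : ℕ} (ha0 : 0 < a) (ha : a ≤ m) :
    ∃ B ⊆ R, B.card = a ∧ (G.induce (B : Set V)).Connected := by
  classical
  have hex : ∃ c, ∃ Z ⊆ R, Z.card = c ∧ m ≤ Z.card ∧ ∀ z ∈ Z, ∀ y ∈ R, G.Adj z y → y ∈ Z :=
    ⟨_, R, subset_rfl, rfl, by omega, fun _ _ y hy _ => hy⟩
  obtain ⟨Z, hZR, hZc, hZm, hZcl⟩ := Nat.find_spec hex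
  obtain ⟨z₀, hz₀⟩ : Z.Nonempty := Finset.card_pos.1 (by omega)
  have h0 : (G.induce (({z₀} : Finset V) : Set V)).Connected := by
    have : Nonempty (({z₀} : Finset V) : Set V) := ⟨⟨z₀, by simp⟩⟩
    refine SimpleGraph.Connected.mk ?_
    rintro ⟨u, hu⟩ ⟨v, hv⟩
    obtain rfl : u = z₀ := by simpa using hu
    obtain rfl : v = u := by simpa using hv
    exact SimpleGraph.Reachable.refl _
  obtain ⟨B, hB, hBmax⟩ := Finset.exists_max_image
    (Z.powerset.filter fun B : Finset V => B.card ≤ a ∧ (G.induce (B : Set V)).Connected) Finset.card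
    ⟨{z₀}, Finset.mem_filter.2 ⟨by simpa using hz₀, by rw [Finset.card_singleton]; exact ha0, h0⟩⟩
  simp only [Finset.mem_filter, Finset.mem_powerset] at hB hBmax
  obtain ⟨hBZ, hBa, hBconn⟩ := hB
  rcases hBa.lt_or_eq with hlt | heq
  swap
  · exact ⟨B, hBZ.trans hZR, heq, hBconn⟩
  exfalso
  have hBne : B.Nonempty := by
    obtain ⟨⟨b, hb⟩⟩ := hBconn.nonempty
    exact ⟨b, hb⟩
  have hclosed : ∀ b ∈ B, ∀ z ∈ Z, G.Adj b z → z ∈ B := by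
    intro b hb z hz hbz
    by_contra hzB
    have hins := hBmax (insert z B) ⟨Finset.insert_subset hz hBZ,
      by rw [Finset.card_insert_of_notMem hzB]; omega, by
        have h1 : (G.induce ((B : Set V) ∪ {z})).Connected :=
          SimpleGraph.connected_induce_union (v := b) (w := z) hBconn.preconnected
            (by
              rintro ⟨u, rfl⟩ ⟨v, rfl⟩
              exact SimpleGraph.Reachable.refl _)
            hb rfl hbz
        have h2 : ((insert z B : Finset V) : Set V) = (B : Set V) ∪ {z} := by
          ext; simp
        rwa [h2]⟩
    rw [Finset.card_insert_of_notMem hzB] at hins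
    omega
  have hlinkfree : ∀ Z' ⊆ R, m ≤ Z'.card → m ≤ (R \ Z').card →
      ∃ s ∈ Z', ∃ t ∈ R \ Z', G.Adj s t := by
    intro Z' _ h1 h2
    obtain ⟨S, hS, hSc⟩ := Finset.exists_subset_card_eq h1
    obtain ⟨T, hT, hTc⟩ := Finset.exists_subset_card_eq h2
    obtain ⟨s, hs, t, ht, hst⟩ := hG S T
      (Finset.disjoint_of_subset_left hS (Finset.disjoint_of_subset_right hT
        Finset.disjoint_sdiff)) hSc hTc
    exact ⟨s, hS hs, t, hT ht, hst⟩
  have hsmall : (Z \ B).card < m := by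
    by_contra! hge
    refine Nat.find_min hex (m := (Z \ B).card) ?_ ⟨Z \ B, Finset.sdiff_subset.trans hZR, rfl,
      hge, ?_⟩
    · rw [← hZc]
      exact Finset.card_lt_card (Finset.sdiff_ssubset hBZ hBne)
    · intro z hz y hy hzy
      rw [Finset.mem_sdiff] at hz ⊢
      have hyZ := hZcl z hz.1 y hy hzy
      exact ⟨hyZ, fun hyB => hz.2 (hclosed y hyB z hz.1 hzy.symm)⟩
  have hcards := Finset.card_sdiff_add_card_eq_card hBZ
  have hcards' := Finset.card_sdiff_add_card_eq_card hZR
  obtain ⟨s, hs, t, ht, hst⟩ := hlinkfree Z hZR hZm (by omega)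
  rw [Finset.mem_sdiff] at ht
  exact ht.2 (hZcl s hs t ht.1 hst)

/-- `𝓑` consists of `M` disjoint connected sets of `a` vertices of `U`. -/
structure IsSegments {V : Type*} (G : SimpleGraph V) (U : Finset V) (a M : ℕ)
    (𝓑 : Finset (Finset V)) : Prop where
  card : 𝓑.card = M
  subset : ∀ B ∈ 𝓑, B ⊆ U
  card_eq : ∀ B ∈ 𝓑, B.card = a
  connected : ∀ B ∈ 𝓑, (G.induce (B : Set V)).Connected
  disj : ∀ B ∈ 𝓑, ∀ B' ∈ 𝓑, B ≠ B' → Disjoint B B'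

lemma IsLinked.exists_isSegments {V : Type*} {G : SimpleGraph V} {m : ℕ} (hG : IsLinked G m)
    {U : Finset V} {a : ℕ} (ha0 : 0 < a) (ha : a ≤ m) (M : ℕ) (hU : M * a + 3 * m ≤ U.card) :
    ∃ 𝓑, IsSegments G U a M 𝓑 := by
  classical
  induction M with
  | zero => exact ⟨∅, by simp, by simp, by simp, by simp, by simp⟩
  | succ M ih =>
    have hmul : (M + 1) * a = M * a + a := by ring
    obtain ⟨𝓑, h𝓑⟩ := ih (by omega)
    have hcov : (𝓑.biUnion id).card ≤ M * a := by
      rw [← h𝓑.card]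
      exact Finset.card_biUnion_le_card_mul _ _ _ fun B hB => (h𝓑.card_eq B hB).le
    have hcov' : 𝓑.biUnion id ⊆ U := Finset.biUnion_subset.2 h𝓑.subset
    have := Finset.card_sdiff_add_card_eq_card hcov'
    obtain ⟨B, hB, hBa, hBc⟩ := hG.exists_connected (R := U \ 𝓑.biUnion id) (by omega) ha0 ha
    have hdis : ∀ B' ∈ 𝓑, Disjoint B B' := fun B' hB' =>
      Finset.disjoint_left.2 fun b hb hb' =>
        (Finset.mem_sdiff.1 (hB hb)).2 (Finset.mem_biUnion.2 ⟨B', hB', hb'⟩)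
    have hnot : B ∉ 𝓑 := fun h => by
      have := hdis B h
      rw [disjoint_self, Finset.bot_eq_empty] at this
      rw [this, Finset.card_empty] at hBa
      omega
    refine ⟨insert B 𝓑, by rw [Finset.card_insert_of_notMem hnot, h𝓑.card], ?_, ?_, ?_, ?_⟩
    · simp only [Finset.forall_mem_insert]
      exact ⟨hB.trans Finset.sdiff_subset, h𝓑.subset⟩
    · simp only [Finset.forall_mem_insert]
      exact ⟨hBa, h𝓑.card_eq⟩
    · simp only [Finset.forall_mem_insert]
      exact ⟨hBc, h𝓑.connected⟩
    · simp only [Finset.forall_mem_insert]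
      exact ⟨⟨fun h => absurd rfl h, fun B' hB' _ => hdis B' hB'⟩,
        fun B' hB' => ⟨fun _ => (hdis B' hB').symm, fun B'' hB'' => h𝓑.disj B' hB' B'' hB''⟩⟩

lemma IsSegments.mono {V : Type*} {G H : SimpleGraph V} {U : Finset V} {a M : ℕ}
    {𝓑 : Finset (Finset V)} (h : IsSegments G U a M 𝓑)
    (hGH : ∀ u ∈ U, ∀ v ∈ U, G.Adj u v → H.Adj u v) : IsSegments H U a M 𝓑 := by
  refine ⟨h.card, h.subset, h.card_eq, fun B hB => (h.connected B hB).mono ?_, h.disj⟩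
  intro u v huv
  exact hGH _ (h.subset B hB u.2) _ (h.subset B hB v.2) huv

/-- The edges of `G` inside `U`. -/
def inside {V : Type*} (G : SimpleGraph V) (U : Finset V) : SimpleGraph V where
  Adj u v := G.Adj u v ∧ u ∈ U ∧ v ∈ U
  symm := ⟨fun _ _ h => ⟨h.1.symm, h.2.2, h.2.1⟩⟩
  loopless := ⟨fun _ h => G.loopless.irrefl _ h.1⟩

open Classical in
/-- A choice of `M` disjoint connected sets of `a` vertices of `U`, which depends only on the edges
inside `U`. -/
noncomputable def segments {V : Type*} (G : SimpleGraph V) (U : Finset V) (a M : ℕ) :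
    Finset (Finset V) :=
  if h : ∃ 𝓑, IsSegments (inside G U) U a M 𝓑 then h.choose else ∅

lemma isSegments_segments {V : Type*} {G : SimpleGraph V} {U : Finset V} {a M : ℕ}
    (h : ∃ 𝓑, IsSegments G U a M 𝓑) : IsSegments G U a M (segments G U a M) := by
  have h' : ∃ 𝓑, IsSegments (inside G U) U a M 𝓑 := by
    obtain ⟨𝓑, h⟩ := h
    exact ⟨𝓑, h.mono fun u hu v hv huv => ⟨huv, hu, hv⟩⟩
  rw [segments, dif_pos h']
  exact h'.choose_spec.mono fun u _ v _ huv => huv.1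

lemma segments_congr {V : Type*} {G G' : SimpleGraph V} {U : Finset V} {a M : ℕ}
    (h : ∀ u ∈ U, ∀ v ∈ U, G.Adj u v ↔ G'.Adj u v) : segments G U a M = segments G' U a M := by
  have : inside G U = inside G' U := by
    ext u v
    constructor
    · rintro ⟨h1, h2, h3⟩
      exact ⟨(h u h2 v h3).1 h1, h2, h3⟩
    · rintro ⟨h1, h2, h3⟩
      exact ⟨(h u h2 v h3).2 h1, h2, h3⟩
  unfold segments
  rw [this]

/-- Each vertex of Z spoils at most one segment, since segments are disjoint. -/
lemma IsSegments.card_le_card_filter_add {V : Type*} [DecidableEq V] {G : SimpleGraph V}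
    {U : Finset V} {a M : ℕ} {𝓑 : Finset (Finset V)} (h : IsSegments G U a M 𝓑) (Z : Finset V) :
    M ≤ (𝓑.filter fun B => Disjoint B Z).card + Z.card := by
  rw [← h.card, ← Finset.card_filter_add_card_filter_not (s := 𝓑) (fun B => Disjoint B Z)]
  refine Nat.add_le_add_left ?_ _
  have hex : ∀ B ∈ 𝓑.filter fun B => ¬ Disjoint B Z, ∃ z, z ∈ B ∧ z ∈ Z := by
    intro B hB
    simpa [Finset.not_disjoint_iff] using (Finset.mem_filter.1 hB).2
  rcases (𝓑.filter fun B => ¬ Disjoint B Z).eq_empty_or_nonempty with he | ⟨B₀, hB₀⟩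
  · simp [he]
  have : Nonempty V := ⟨(hex B₀ hB₀).choose⟩
  choose! f hf using hex
  refine Finset.card_le_card_of_injOn f (fun B hB => (hf B hB).2) ?_
  intro B hB B' hB' heq
  by_contra hne
  have h1 := hf B hB
  have h2 := hf B' hB'
  exact Finset.disjoint_left.1 (h.disj B (Finset.mem_filter.1 hB).1 B' (Finset.mem_filter.1 hB').1
    hne) h1.1 (heq ▸ h2.1)

/-! ### Matching neighbours of the root to segments -/

lemma adj_iff_of_agree {V : Type*} {G G' : SimpleGraph V} {D : Finset (Sym2 V)}
    (h : ∀ e ∉ D, e ∈ G.edgeSet ↔ e ∈ G'.edgeSet) {u v : V} (huv : s(u, v) ∉ D) :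
    G.Adj u v ↔ G'.Adj u v := by
  have := h _ huv
  rwa [SimpleGraph.mem_edgeSet, SimpleGraph.mem_edgeSet] at this

lemma nb_eq_of_agree {V : Type*} [Fintype V] {G G' : SimpleGraph V} {D : Finset (Sym2 V)}
    (h : ∀ e ∉ D, e ∈ G.edgeSet ↔ e ∈ G'.edgeSet) {v : V} (hv : ∀ w, s(v, w) ∉ D) :
    nb G' v = nb G v := by
  ext w
  rw [mem_nb, mem_nb]
  exact (adj_iff_of_agree h (hv w)).symm

/-- Distinct neighbours of `r` outside `U` can be joined to distinct members of `𝓑` that avoid `r`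
and its neighbours. -/
def HasSegmentMatching {V : Type*} [Fintype V] (G : SimpleGraph V) (r : V) (U : Finset V)
    (𝓑 : Finset (Finset V)) : Prop :=
  ∃ f : V → Finset V, (∀ x, G.Adj r x → x ∉ U → f x ∈ 𝓑 ∧ r ∉ f x ∧ (∀ y ∈ f x, ¬ G.Adj r y) ∧
    ∃ b ∈ f x, G.Adj x b) ∧
    ∀ x y, G.Adj r x → x ∉ U → G.Adj r y → y ∉ U → f x = f y → x = y

/-- S is a set violating Hall's condition. The segments reachable from S are recorded by one
representative vertex each, forming W. Any segment avoiding W is then unreachable, and the union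
bound can range over vertex sets instead of families of segments. -/
lemma exists_obstruction_of_not_hasSegmentMatching {V : Type*} [Fintype V] [DecidableEq V]
    {G : SimpleGraph V}
    {r : V} {U : Finset V} {𝓑 : Finset (Finset V)} (h : ¬ HasSegmentMatching G r U 𝓑) :
    ∃ S W : Finset V, S.Nonempty ∧ W.card ≤ S.card ∧ S ⊆ nb G r ∧ Disjoint S U ∧
      ∀ B ∈ 𝓑, Disjoint B (W ∪ insert r (nb G r)) → ∀ x ∈ S, ∀ b ∈ B, ¬ G.Adj x b := by
  classical
  let ι := {x // x ∈ nb G r \ U}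
  let t : ι → Finset (Finset V) := fun x =>
    𝓑.filter fun B => Disjoint B (insert r (nb G r)) ∧ ∃ b ∈ B, G.Adj x b
  by_cases hall : ∀ s : Finset ι, s.card ≤ (s.biUnion t).card
  · exfalso
    obtain ⟨f, hf, hft⟩ := (Finset.all_card_le_biUnion_card_iff_exists_injective t).1 hall
    apply h
    refine ⟨fun x => if hx : x ∈ nb G r \ U then f ⟨x, hx⟩ else ∅, ?_, ?_⟩
    · intro x hx hxU
      have hx' : x ∈ nb G r \ U := by simp [hx, hxU]
      simp only [dif_pos hx']
      have := hft ⟨x, hx'⟩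
      simp only [t, Finset.mem_filter, Finset.disjoint_insert_right] at this
      obtain ⟨h1, ⟨h2, h3⟩, h4⟩ := this
      exact ⟨h1, h2, fun y hy hry => Finset.disjoint_left.1 h3 hy (by simpa using hry), h4⟩
    · intro x y hx hxU hy hyU hxy
      have hx' : x ∈ nb G r \ U := by simp [hx, hxU]
      have hy' : y ∈ nb G r \ U := by simp [hy, hyU]
      simp only [dif_pos hx', dif_pos hy'] at hxy
      exact congrArg Subtype.val (hf hxy)
  · push Not at hall
    obtain ⟨s, hs⟩ := hall
    let pick : Finset V → V := fun B => if hB : B.Nonempty then hB.choose else r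
    have hpick : ∀ B : Finset V, B.Nonempty → pick B ∈ B := fun B hB => by
      simp only [pick, dif_pos hB]
      exact hB.choose_spec
    have hscard : (s.image Subtype.val).card = s.card :=
      Finset.card_image_of_injective _ Subtype.val_injective
    refine ⟨s.image Subtype.val, (s.biUnion t).image pick, ?_, ?_, ?_, ?_, ?_⟩
    · rw [Finset.image_nonempty, ← Finset.card_pos]
      omega
    · rw [hscard]
      exact Finset.card_image_le.trans hs.le
    · intro x hx
      obtain ⟨y, -, rfl⟩ := Finset.mem_image.1 hx
      exact (Finset.mem_sdiff.1 y.2).1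
    · refine Finset.disjoint_left.2 fun x hx => ?_
      obtain ⟨y, -, rfl⟩ := Finset.mem_image.1 hx
      exact (Finset.mem_sdiff.1 y.2).2
    · intro B hB hdisj x hx b hb hxb
      obtain ⟨y, hy, rfl⟩ := Finset.mem_image.1 hx
      rw [Finset.disjoint_union_right] at hdisj
      have hBt : B ∈ t y := Finset.mem_filter.2 ⟨hB, hdisj.2, b, hb, hxb⟩
      refine Finset.disjoint_left.1 hdisj.1 (hpick B ⟨b, hb⟩) ?_
      exact Finset.mem_image_of_mem _ (Finset.mem_biUnion.2 ⟨y, hy, hBt⟩)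

open Classical in
/-- The pairs between `S` and the segments in `U` that avoid `W`, `r` and the neighbours of `r`. -/
noncomputable def segmentPairs {V : Type*} [Fintype V] (U : Finset V) (a M : ℕ) (r : V)
    (S W : Finset V) (G : SimpleGraph V) : Finset (Sym2 V) :=
  if r ∉ S ∧ Disjoint S U then
    (S ×ˢ (((segments G U a M).filter fun B => Disjoint B (W ∪ insert r (nb G r))).biUnion id ∩ U)
      ).image fun x => s(x.1, x.2)
  else ∅

/-- The segments are read off from edges inside U and the neighbourhood of r from edges at r. As S
avoids both U and r, and the segments used avoid r, no pair in the set is of either kind. -/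
lemma isFree_segmentPairs {V : Type*} [Fintype V] (U : Finset V) (a M : ℕ) (r : V)
    (S W : Finset V) : IsFree (segmentPairs U a M r S W) := by
  classical
  by_cases h : r ∉ S ∧ Disjoint S U
  swap
  · have : segmentPairs U a M r S W = fun _ => ∅ := by
      funext G
      rw [segmentPairs, if_neg h]
    rw [this]
    exact isFree_const (by simp)
  have hdef : ∀ G, segmentPairs U a M r S W G =
      (S ×ˢ (((segments G U a M).filter fun B =>
        Disjoint B (W ∪ insert r (nb G r))).biUnion id ∩ U)).image fun x => s(x.1, x.2) := by
    intro G
    rw [segmentPairs, if_pos h]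
  have hmem : ∀ G e, e ∈ segmentPairs U a M r S W G → ∃ x ∈ S, ∃ b ∈ U, b ≠ r ∧ e = s(x, b) := by
    intro G e he
    rw [hdef] at he
    obtain ⟨⟨x, b⟩, hxb, rfl⟩ := Finset.mem_image.1 he
    simp only [Finset.mem_product, Finset.mem_inter, Finset.mem_biUnion, Finset.mem_filter,
      id] at hxb
    obtain ⟨hx, ⟨B, ⟨-, hB⟩, hbB⟩, hbU⟩ := hxb
    refine ⟨x, hx, b, hbU, ?_, rfl⟩
    rintro rfl
    exact Finset.disjoint_left.1 hB hbB (by simp)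
  refine ⟨fun G e he hd => ?_, fun G G' hagree => ?_⟩
  · obtain ⟨x, hx, b, hb, -, rfl⟩ := hmem G e he
    rw [Sym2.mk_isDiag_iff] at hd
    exact Finset.disjoint_left.1 h.2 hx (hd ▸ hb)
  · have h1 : segments G' U a M = segments G U a M := by
      refine segments_congr fun u hu v hv => (adj_iff_of_agree hagree fun huv => ?_).symm
      obtain ⟨x, hx, b, hb, -, heq⟩ := hmem G _ huv
      rw [Sym2.eq_iff] at heq
      rcases heq with ⟨rfl, -⟩ | ⟨-, rfl⟩
      · exact Finset.disjoint_left.1 h.2 hx hu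
      · exact Finset.disjoint_left.1 h.2 hx hv
    have h2 : nb G' r = nb G r := by
      refine nb_eq_of_agree hagree fun w hw => ?_
      obtain ⟨x, hx, b, hb, hbr, heq⟩ := hmem G _ hw
      rw [Sym2.eq_iff] at heq
      rcases heq with ⟨rfl, -⟩ | ⟨rfl, -⟩
      · exact h.1 hx
      · exact hbr rfl
    rw [hdef, hdef, h1, h2]

/-- W, r and the neighbours of r spoil at most 2d + 1 segments, because |W| ≤ |S| ≤ d. The remaining
ones supply |S|·a·(M - (2d + 1)) free pairs, none of which may be an edge. -/
theorem prob_not_hasSegmentMatching_le {V : Type*} [Fintype V] [Nonempty V] (p : I)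
    (U : Finset V) {a M d : ℕ}
    (hp : 10 * Real.log (Fintype.card V) ≤ p * (a * (M - (2 * d + 1)))) :
    G(V, p).real {G | (∃ 𝓑, IsSegments G U a M 𝓑) ∧ (∀ v, (nb G v).card ≤ d) ∧
      ∃ r, ¬ HasSegmentMatching G r U (segments G U a M)} ≤
      Fintype.card V * (9 * ((Fintype.card V : ℝ)⁻¹) ^ 8) := by
  classical
  let E : V → Finset V → Finset V → Set (SimpleGraph V) := fun r S W =>
    {G | (∃ 𝓑, IsSegments G U a M 𝓑) ∧ (∀ v, (nb G v).card ≤ d) ∧ W.card ≤ S.card ∧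
      S ⊆ nb G r ∧ Disjoint S U ∧ ∀ B ∈ segments G U a M,
        Disjoint B (W ∪ insert r (nb G r)) → ∀ x ∈ S, ∀ b ∈ B, ¬ G.Adj x b}
  refine le_trans ?_ (measureReal_exists_le G(V, p) (fun r =>
    {G | ∃ S W : Finset V, S.Nonempty ∧ W.card ≤ S.card ∧ G ∈ E r S W}) fun r =>
      measureReal_exists_pair_le G(V, p) (E r) ?_)
  · refine MeasureTheory.measureReal_mono ?_
    rintro G ⟨h1, h2, r, hr⟩
    obtain ⟨S, W, hS, hW, h3, h4, h5⟩ := exists_obstruction_of_not_hasSegmentMatching hr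
    exact ⟨r, S, W, hS, hW, h1, h2, hW, h3, h4, h5⟩
  · intro S W hS hW
    refine ((isFree_segmentPairs U a M r S W).prob_avoid_le p
      (q := S.card * (a * (M - (2 * d + 1)))) ?_).trans (Real.exp_le_exp.2 ?_)
    · rintro G ⟨h1, h2, -, h3, h4, h5⟩
      have hseg := isSegments_segments h1
      have hrS : r ∉ S := fun hr => by
        have := h3 hr
        simp at this
      have hdef : segmentPairs U a M r S W G =
          (S ×ˢ (((segments G U a M).filter fun B =>
            Disjoint B (W ∪ insert r (nb G r))).biUnion id ∩ U)).image fun x => s(x.1, x.2) := by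
        rw [segmentPairs, if_pos ⟨hrS, h4⟩]
      set 𝓒 := (segments G U a M).filter fun B => Disjoint B (W ∪ insert r (nb G r)) with h𝓒
      constructor
      · have hsub : 𝓒.biUnion id ∩ U = 𝓒.biUnion id :=
          Finset.inter_eq_left.2 (Finset.biUnion_subset.2 fun B hB =>
            hseg.subset B (Finset.mem_filter.1 hB).1)
        have hcard : (𝓒.biUnion id).card = 𝓒.card * a := by
          rw [Finset.card_biUnion]
          · exact Finset.sum_const_nat fun B hB => hseg.card_eq B (Finset.mem_filter.1 hB).1
          · intro B hB B' hB' hne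
            exact hseg.disj B (Finset.mem_filter.1 hB).1 B' (Finset.mem_filter.1 hB').1 hne
        have hZ : (W ∪ insert r (nb G r)).card ≤ 2 * d + 1 := by
          have := Finset.card_union_le W (insert r (nb G r))
          have := Finset.card_insert_le r (nb G r)
          have := Finset.card_le_card h3
          have := h2 r
          omega
        have hM : M ≤ 𝓒.card + (W ∪ insert r (nb G r)).card := by
          convert hseg.card_le_card_filter_add (W ∪ insert r (nb G r)) using 3
        have hM' : (M : ℝ) - (2 * d + 1) ≤ 𝓒.card := by
          rw [sub_le_iff_le_add]
          have : M ≤ 𝓒.card + (2 * d + 1) := by omega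
          exact_mod_cast this
        rw [hdef, card_image_sym2_mk (Finset.disjoint_of_subset_right Finset.inter_subset_right h4),
          hsub, hcard]
        push_cast
        refine mul_le_mul_of_nonneg_left ?_ (by positivity)
        rw [mul_comm]
        exact mul_le_mul_of_nonneg_right hM' (by positivity)
      · intro e he
        rw [hdef] at he
        obtain ⟨⟨x, b⟩, hxb, rfl⟩ := Finset.mem_image.1 he
        simp only [h𝓒, Finset.mem_product, Finset.mem_inter, Finset.mem_biUnion,
          Finset.mem_filter, id] at hxb
        obtain ⟨hx, ⟨B, ⟨hB, hBd⟩, hbB⟩, -⟩ := hxb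
        exact h5 B hB hBd x hx b hbB
    · have h0 : (0 : ℝ) ≤ S.card := by positivity
      nlinarith [mul_le_mul_of_nonneg_right hp h0]

/-! ### Choosing the remaining parents by Hall's theorem -/

/-- A choice of the sets `A x` and the function `ρ` of `IsRooted` for every graph, together with a
set `D` of pairs such that this choice is unaffected by changes of the graph on `D`. -/
structure CoreChoice (V : Type*) [Fintype V] (r : V) where
  A : SimpleGraph V → V → Finset V
  ρ : SimpleGraph V → V → ℕ
  D : SimpleGraph V → Finset (Sym2 V)
  congr : ∀ G G', (∀ e ∉ D G, e ∈ G.edgeSet ↔ e ∈ G'.edgeSet) →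
    nb G' r = nb G r ∧ A G' = A G ∧ ρ G' = ρ G ∧ D G' = D G

open Classical in
/-- The chosen sets form a rooted family, and `D G` contains at least `a` pairs between every `A x`
and every vertex that is not adjacent to the root. -/
structure CoreChoice.IsGood {V : Type*} [Fintype V] {r : V} (c : CoreChoice V r) (a : ℕ)
    (G : SimpleGraph V) : Prop where
  isRooted : IsRooted G r (c.A G) (c.ρ G)
  le_card : ∀ x, G.Adj r x → ∀ w, w ≠ r → ¬ G.Adj r w → w ∉ c.A G x →
    a ≤ ((c.A G x).filter fun b => s(w, b) ∈ c.D G).card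

open Classical in
/-- The members of `X` whose set `A x` contains no neighbour of `v`. -/
noncomputable def missed {V : Type*} (G : SimpleGraph V) (A : V → Finset V) (X : Finset V) (v : V) :
    Finset V :=
  X.filter fun x => ∀ w ∈ A x, ¬ G.Adj v w

open Classical in
/-- The neighbours of `v` that are not its parent in a tree with a neighbour of `v` in `A x`. -/
noncomputable def available {V : Type*} [Fintype V] (G : SimpleGraph V) (A : V → Finset V)
    (ρ : V → ℕ) (X : Finset V) (v : V) : Finset V :=
  nb G v \ (X.filter fun x => ∃ w ∈ A x, G.Adj v w).image fun x => lowNbr G ρ (A x) v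

lemma mem_missed {V : Type*} {G : SimpleGraph V} {A : V → Finset V} {X : Finset V} {v x : V} :
    x ∈ missed G A X v ↔ x ∈ X ∧ ∀ w ∈ A x, ¬ G.Adj v w := by
  simp [missed]

lemma mem_available {V : Type*} [Fintype V] {G : SimpleGraph V} {A : V → Finset V} {ρ : V → ℕ}
    {X : Finset V} {v w : V} : w ∈ available G A ρ X v ↔
      G.Adj v w ∧ ∀ x ∈ X, (∃ w ∈ A x, G.Adj v w) → w ≠ lowNbr G ρ (A x) v := by
  simp only [available, Finset.mem_sdiff, mem_nb, Finset.mem_image, Finset.mem_filter, not_exists,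
    not_and, and_imp]
  refine and_congr_right fun _ => ?_
  constructor
  · exact fun h x hx hb heq => h x hx hb heq.symm
  · exact fun h x hx hb heq => h x hx hb heq.symm

/-- At most |X| - |missed| neighbours of v are used as parents in cores, and v has at least |X|
neighbours. -/
lemma card_missed_le_card_available {V : Type*} [Fintype V] {G : SimpleGraph V}
    {A : V → Finset V} {ρ : V → ℕ} {X : Finset V} {v : V} (h : X.card ≤ (nb G v).card) :
    (missed G A X v).card ≤ (available G A ρ X v).card := by
  classical
  have h1 := Finset.card_filter_add_card_filter_not (s := X) fun x => ∀ w ∈ A x, ¬ G.Adj v w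
  have h2 : (X.filter fun x => ¬ ∀ w ∈ A x, ¬ G.Adj v w) =
      X.filter fun x => ∃ w ∈ A x, G.Adj v w := by
    refine Finset.filter_congr fun x _ => ?_
    push Not
    rfl
  rw [h2] at h1
  have h3 := Finset.le_card_sdiff
    ((X.filter fun x => ∃ w ∈ A x, G.Adj v w).image fun x => lowNbr G ρ (A x) v) (nb G v)
  have h4 := Finset.card_image_le (s := X.filter fun x => ∃ w ∈ A x, G.Adj v w)
    (f := fun x => lowNbr G ρ (A x) v)
  have h5 : (missed G A X v).card = (X.filter fun x => ∀ w ∈ A x, ¬ G.Adj v w).card := by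
    rw [missed]
    congr!
  have h6 : (available G A ρ X v).card = (nb G v \ (X.filter fun x => ∃ w ∈ A x, G.Adj v w).image
      fun x => lowNbr G ρ (A x) v).card := by
    rw [available]
  rw [h5, h6]
  omega

lemma missed_congr {V : Type*} {G G' : SimpleGraph V} {A : V → Finset V} {X : Finset V} {v : V}
    (h : G.Adj v = G'.Adj v) : missed G A X v = missed G' A X v := by
  unfold missed
  rw [h]

lemma available_congr {V : Type*} [Fintype V] {G G' : SimpleGraph V} {A : V → Finset V} {ρ : V → ℕ}
    {X : Finset V} {v : V} (h : G.Adj v = G'.Adj v) :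
    available G A ρ X v = available G' A ρ X v := by
  unfold available nb lowNbr
  rw [h]

-- A set s violating Hall's condition has a smaller neighbourhood W among the available vertices,
-- and there are no connections between the rest of them and the cores of s. Describing this
-- directly could be too expensive when s is large; the two cases keep the description proportional
-- to the smaller side.
open Classical in
lemma exists_obstruction_of_not_isMatched {V : Type*} [Fintype V] {G : SimpleGraph V} {r : V}
    {A : V → Finset V} {ρ : V → ℕ} {X : Finset V} {v : V} (hv : ¬ G.Adj r v)
    (hcard : X.card ≤ (nb G v).card) (h : ¬ ∃ g, IsMatched G r A ρ X v g) :
    ∃ T ⊆ available G A ρ X v, ∃ J ⊆ missed G A X v, ∃ P R : Finset V, P.Nonempty ∧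
      R.card ≤ P.card ∧ P.card * (missed G A X v).card ≤ 2 * (T.card * J.card) ∧
      ((T = available G A ρ X v \ R ∧ J = missed G A X v ∩ P) ∨
        (T = available G A ρ X v ∩ P ∧ J = missed G A X v \ R)) ∧
      ∀ w ∈ T, w ≠ r ∧ ¬ G.Adj r w ∧ ∀ x ∈ J, ∀ b ∈ A x, ¬ G.Adj w b := by
  have hle := card_missed_le_card_available (A := A) (ρ := ρ) hcard
  set M := missed G A X v with hM
  set F := available G A ρ X v with hF
  let ι := {x // x ∈ M}
  let t : ι → Finset V := fun x => F.filter fun w => G.Adj r w ∨ ∃ b ∈ A x, G.Adj w b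
  by_cases hall : ∀ s : Finset ι, s.card ≤ (s.biUnion t).card
  · exfalso
    obtain ⟨f, hf, hft⟩ := (Finset.all_card_le_biUnion_card_iff_exists_injective t).1 hall
    apply h
    refine ⟨fun x => if hx : x ∈ M then f ⟨x, hx⟩ else r, ?_, ?_, ?_, ?_⟩
    · intro x hx y hy hx' hy' heq
      have hxM : x ∈ M := mem_missed.2 ⟨hx, hx'⟩
      have hyM : y ∈ M := mem_missed.2 ⟨hy, hy'⟩
      simp only [dif_pos hxM, dif_pos hyM] at heq
      exact congrArg Subtype.val (hf heq)
    · intro x hx hx'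
      have hxM : x ∈ M := mem_missed.2 ⟨hx, hx'⟩
      simp only [dif_pos hxM]
      exact (mem_available.1 (Finset.mem_filter.1 (hft ⟨x, hxM⟩)).1).1
    · intro x hx hx' y hy hy'
      have hxM : x ∈ M := mem_missed.2 ⟨hx, hx'⟩
      simp only [dif_pos hxM]
      exact (mem_available.1 (Finset.mem_filter.1 (hft ⟨x, hxM⟩)).1).2 y hy hy'
    · intro x hx hx'
      have hxM : x ∈ M := mem_missed.2 ⟨hx, hx'⟩
      simp only [dif_pos hxM]
      exact (Finset.mem_filter.1 (hft ⟨x, hxM⟩)).2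
  · push Not at hall
    obtain ⟨s, hs⟩ := hall
    set J := s.image Subtype.val with hJ
    set W := s.biUnion t with hW
    have hJc : J.card = s.card := Finset.card_image_of_injective _ Subtype.val_injective
    have hJM : J ⊆ M := by
      intro x hx
      obtain ⟨y, -, rfl⟩ := Finset.mem_image.1 hx
      exact y.2
    have hWF : W ⊆ F := Finset.biUnion_subset.2 fun x _ => Finset.filter_subset _ _
    have hno : ∀ w ∈ F \ W, w ≠ r ∧ ¬ G.Adj r w ∧ ∀ x ∈ J, ∀ b ∈ A x, ¬ G.Adj w b := by
      intro w hw
      rw [Finset.mem_sdiff] at hw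
      obtain ⟨hwF, hwW⟩ := hw
      have hvw := (mem_available.1 hwF).1
      have hnot : ∀ y ∈ s, ¬ (G.Adj r w ∨ ∃ b ∈ A y, G.Adj w b) := fun y hy hor =>
        hwW (Finset.mem_biUnion.2 ⟨y, hy, Finset.mem_filter.2 ⟨hwF, hor⟩⟩)
      obtain ⟨y₀, hy₀⟩ : s.Nonempty := Finset.card_pos.1 (by omega)
      refine ⟨?_, fun hrw => hnot y₀ hy₀ (Or.inl hrw), ?_⟩
      · rintro rfl
        exact hv hvw.symm
      · intro x hx b hb hwb
        obtain ⟨y, hy, rfl⟩ := Finset.mem_image.1 hx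
        exact hnot y hy (Or.inr ⟨b, hb, hwb⟩)
    have hFW := Finset.card_sdiff_add_card_eq_card hWF
    have hMJ := Finset.card_sdiff_add_card_eq_card hJM
    -- For small s, describe J = s by P and its neighbourhood by R; at least half as many vertices
    -- as `missed` remain in T. For large s, describe J by its complement R in `missed`, and shrink
    -- T to a set P of |M| - |s| + 1 vertices, which is nonempty and at least as large as R.
    by_cases hcase : 2 * s.card ≤ M.card
    · refine ⟨F \ W, Finset.sdiff_subset, J, hJM, J, W, Finset.card_pos.1 (by omega), by omega,
        ?_, Or.inl ⟨rfl, (Finset.inter_eq_right.2 hJM).symm⟩, hno⟩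
      have : M.card ≤ 2 * (F \ W).card := by omega
      nlinarith
    · obtain ⟨P, hP, hPc⟩ := Finset.exists_subset_card_eq
        (show M.card - s.card + 1 ≤ (F \ W).card by
          have := Finset.card_le_card hJM
          omega)
      refine ⟨P, hP.trans Finset.sdiff_subset, J, hJM, P, M \ J, Finset.card_pos.1 (by omega),
        by omega, ?_, Or.inr ⟨(Finset.inter_eq_right.2 (hP.trans Finset.sdiff_subset)).symm, ?_⟩,
        fun w hw => hno w (hP hw)⟩
      · have : M.card ≤ 2 * J.card := by omega
        nlinarith
      · rw [Finset.sdiff_sdiff_eq_self hJM]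

open Classical in
/-- The pairs in `D` that join `T ∩ available` to the sets `A x` with `x` in `J ∩ missed`, where `T`
and `J` may depend on `available` and `missed`. -/
noncomputable def CoreChoice.pairs {V : Type*} [Fintype V] {r : V} (c : CoreChoice V r)
    (sel : Finset V → Finset V) (v : V) (tsel jsel : Finset V → Finset V) (G : SimpleGraph V) :
    Finset (Sym2 V) :=
  ((tsel (available G (c.A G) (c.ρ G) (sel (nb G r)) v)).sigma fun w =>
    ((jsel (missed G (c.A G) (sel (nb G r)) v)).biUnion (c.A G)).filter fun b =>
      s(w, b) ∈ c.D G ∧ w ≠ b ∧ w ≠ v ∧ b ≠ v).image fun x => s(x.1, x.2)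

lemma CoreChoice.mem_pairs {V : Type*} [Fintype V] {r : V} {c : CoreChoice V r}
    {sel : Finset V → Finset V} {v : V} {tsel jsel : Finset V → Finset V} {G : SimpleGraph V}
    {e : Sym2 V} : e ∈ c.pairs sel v tsel jsel G ↔
      ∃ w ∈ tsel (available G (c.A G) (c.ρ G) (sel (nb G r)) v),
        ∃ x ∈ jsel (missed G (c.A G) (sel (nb G r)) v), ∃ b ∈ c.A G x,
          s(w, b) ∈ c.D G ∧ w ≠ b ∧ w ≠ v ∧ b ≠ v ∧ e = s(w, b) := by
  classical
  rw [CoreChoice.pairs, Finset.mem_image]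
  constructor
  · rintro ⟨⟨w, b⟩, h, rfl⟩
    simp only [Finset.mem_sigma, Finset.mem_filter, Finset.mem_biUnion] at h
    obtain ⟨hw, ⟨x, hx, hb⟩, h1, h2, h3, h4⟩ := h
    exact ⟨w, hw, x, hx, b, hb, h1, h2, h3, h4, rfl⟩
  · rintro ⟨w, hw, x, hx, b, hb, h1, h2, h3, h4, rfl⟩
    refine ⟨⟨w, b⟩, ?_, rfl⟩
    simp only [Finset.mem_sigma, Finset.mem_filter, Finset.mem_biUnion]
    exact ⟨hw, ⟨x, hx, hb⟩, h1, h2, h3, h4⟩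

/-- The cores and the neighbours of r are determined outside D, and `available` and `missed` then
require only the edges at v. This is why pairs meeting v are excluded. -/
lemma CoreChoice.isFree_pairs {V : Type*} [Fintype V] {r : V} (c : CoreChoice V r)
    (sel : Finset V → Finset V) (v : V) (tsel jsel : Finset V → Finset V) :
    IsFree (c.pairs sel v tsel jsel) := by
  classical
  refine ⟨fun G e he hd => ?_, fun G G' hagree => ?_⟩
  · obtain ⟨w, -, x, -, b, -, -, hwb, -, -, rfl⟩ := CoreChoice.mem_pairs.1 he
    exact hwb (Sym2.mk_isDiag_iff.1 hd)
  · obtain ⟨h1, h2, h3, h4⟩ := c.congr G G' fun e he => hagree e fun he' => by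
      obtain ⟨w, -, x, -, b, -, hD, -, -, -, rfl⟩ := CoreChoice.mem_pairs.1 he'
      exact he hD
    have hv : G'.Adj v = G.Adj v := by
      funext u
      refine propext (adj_iff_of_agree hagree fun he' => ?_).symm
      obtain ⟨w, -, x, -, b, -, -, -, hw, hb, heq⟩ := CoreChoice.mem_pairs.1 he'
      rw [Sym2.eq_iff] at heq
      rcases heq with ⟨rfl, -⟩ | ⟨rfl, -⟩
      · exact hw rfl
      · exact hb rfl
    unfold CoreChoice.pairs
    rw [h1, h2, h3, h4, missed_congr hv, available_congr hv]

/-- A pair may be counted from both ends, since vertices of T may themselves lie in cores. -/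
lemma card_sigma_le_two_mul_card_image {V : Type*} [DecidableEq V] (s : Finset (Σ _ : V, V)) :
    s.card ≤ 2 * (s.image fun x => s(x.1, x.2)).card := by
  refine Finset.card_le_mul_card_image s 2 fun e he => ?_
  obtain ⟨⟨a, b⟩, -, rfl⟩ := Finset.mem_image.1 he
  refine (Finset.card_le_card (t := {⟨a, b⟩, ⟨b, a⟩}) ?_).trans Finset.card_le_two
  rintro ⟨c, d⟩ hcd
  have := (Finset.mem_filter.1 hcd).2
  simp only [Sym2.eq_iff] at this
  simp only [Finset.mem_insert, Finset.mem_singleton]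
  rcases this with ⟨rfl, rfl⟩ | ⟨rfl, rfl⟩ <;> simp

/-- The exclusions in `pairs` lose nothing. A vertex w of T is adjacent to v and hence in no missed
core. Nor is v in one: v ≠ x, so descent would give v a neighbour in that core. -/
lemma CoreChoice.IsGood.le_card_pairs {V : Type*} [Fintype V] {r : V} {c : CoreChoice V r} {a : ℕ}
    {G : SimpleGraph V} (hG : c.IsGood a G) {sel : Finset V → Finset V}
    (hsel : sel (nb G r) ⊆ nb G r) {v : V} (hvr : v ≠ r) (hrv : ¬ G.Adj r v)
    {tsel jsel : Finset V → Finset V}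
    (ht : tsel (available G (c.A G) (c.ρ G) (sel (nb G r)) v) ⊆
      available G (c.A G) (c.ρ G) (sel (nb G r)) v)
    (hj : jsel (missed G (c.A G) (sel (nb G r)) v) ⊆ missed G (c.A G) (sel (nb G r)) v)
    (hT : ∀ w ∈ tsel (available G (c.A G) (c.ρ G) (sel (nb G r)) v), w ≠ r ∧ ¬ G.Adj r w) :
    (tsel (available G (c.A G) (c.ρ G) (sel (nb G r)) v)).card *
      (jsel (missed G (c.A G) (sel (nb G r)) v)).card * a ≤
        2 * (c.pairs sel v tsel jsel G).card := by
  classical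
  set T := tsel (available G (c.A G) (c.ρ G) (sel (nb G r)) v) with hTdef
  set J := jsel (missed G (c.A G) (sel (nb G r)) v) with hJdef
  have hpairs : (c.pairs sel v tsel jsel G) = (T.sigma fun w =>
    (J.biUnion (c.A G)).filter fun b =>
      s(w, b) ∈ c.D G ∧ w ≠ b ∧ w ≠ v ∧ b ≠ v).image fun x => s(x.1, x.2) := by
    rw [CoreChoice.pairs]
  rw [hpairs]
  refine le_trans ?_ (card_sigma_le_two_mul_card_image _)
  rw [Finset.card_sigma, mul_assoc, ← smul_eq_mul]
  refine Finset.card_nsmul_le_sum _ _ _ fun w hw => ?_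
  have hwv : G.Adj v w := (mem_available.1 (ht hw)).1
  obtain ⟨hwr, hrw⟩ := hT w hw
  have hJr : ∀ x ∈ J, G.Adj r x ∧ ∀ b ∈ c.A G x, ¬ G.Adj v b := fun x hx => by
    have := mem_missed.1 (hj hx)
    exact ⟨by simpa using hsel this.1, this.2⟩
  have hsub : (J.biUnion fun x => (c.A G x).filter fun b => s(w, b) ∈ c.D G) ⊆
      (J.biUnion (c.A G)).filter fun b => s(w, b) ∈ c.D G ∧ w ≠ b ∧ w ≠ v ∧ b ≠ v := by
    intro b hb
    obtain ⟨x, hx, hb⟩ := Finset.mem_biUnion.1 hb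
    obtain ⟨hbA, hbD⟩ := Finset.mem_filter.1 hb
    refine Finset.mem_filter.2 ⟨Finset.mem_biUnion.2 ⟨x, hx, hbA⟩, hbD, ?_, hwv.ne', ?_⟩
    · rintro rfl
      exact (hJr x hx).2 _ hbA hwv
    · rintro rfl
      have hbx : b ≠ x := by
        rintro rfl
        exact hrv (hJr _ hx).1
      obtain ⟨u, hu, hbu, -⟩ := hG.isRooted.descend x (hJr x hx).1 b hbA hbx
      exact (hJr x hx).2 u hu hbu
  refine le_trans ?_ (Finset.card_le_card hsub)
  rw [Finset.card_biUnion]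
  · rw [← smul_eq_mul]
    refine Finset.card_nsmul_le_sum _ _ _ fun x hx => ?_
    exact hG.le_card x (hJr x hx).1 w hwr hrw fun hwA => (hJr x hx).2 w hwA hwv
  · intro x hx y hy hxy
    exact Finset.disjoint_filter_filter (hG.isRooted.disj x y (hJr x hx).1 (hJr y hy).1 hxy)

lemma CoreChoice.prob_no_pairs_le {V : Type*} [Fintype V] {r : V} (c : CoreChoice V r) (p : I)
    {a : ℕ} (sel : Finset V → Finset V) (v : V) (tsel jsel : Finset V → Finset V) (q : ℝ) :
    G(V, p).real {G | c.IsGood a G ∧ sel (nb G r) ⊆ nb G r ∧ v ≠ r ∧ ¬ G.Adj r v ∧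
      ∃ T ⊆ available G (c.A G) (c.ρ G) (sel (nb G r)) v,
        ∃ J ⊆ missed G (c.A G) (sel (nb G r)) v,
          T = tsel (available G (c.A G) (c.ρ G) (sel (nb G r)) v) ∧
          J = jsel (missed G (c.A G) (sel (nb G r)) v) ∧
          2 * q ≤ T.card * J.card * a ∧
          ∀ w ∈ T, w ≠ r ∧ ¬ G.Adj r w ∧ ∀ x ∈ J, ∀ b ∈ c.A G x, ¬ G.Adj w b} ≤
      Real.exp (-(p * q)) := by
  refine (c.isFree_pairs sel v tsel jsel).prob_avoid_le p ?_
  rintro G ⟨hG, hsel, hvr, hrv, T, hT, J, hJ, rfl, rfl, hq, hno⟩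
  constructor
  · have := hG.le_card_pairs hsel hvr hrv hT hJ fun w hw => ⟨(hno w hw).1, (hno w hw).2.1⟩
    have : ((tsel (available G (c.A G) (c.ρ G) (sel (nb G r)) v)).card : ℝ) *
      (jsel (missed G (c.A G) (sel (nb G r)) v)).card * a ≤
        2 * (c.pairs sel v tsel jsel G).card := by exact_mod_cast this
    linarith
  · intro e he
    obtain ⟨w, hw, x, hx, b, hb, -, -, -, -, rfl⟩ := CoreChoice.mem_pairs.1 he
    exact (hno w hw).2.2 x hx b hb

/-- The set `sel` may depend only on the neighbourhood of r, which is exposed before the free pairs.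
The two events E₁ and E₂ correspond to the two forms of the Hall obstruction. -/
theorem CoreChoice.prob_not_isMatched_le {V : Type*} [Fintype V] [Nonempty V] {r : V}
    (c : CoreChoice V r) (p : I) {a : ℕ} {m : ℝ}
    (hp : 40 * Real.log (Fintype.card V) ≤ p * (a * m)) (sel : Finset V → Finset V) :
    G(V, p).real {G | c.IsGood a G ∧ sel (nb G r) ⊆ nb G r ∧ ∃ v, v ≠ r ∧ ¬ G.Adj r v ∧
      (sel (nb G r)).card ≤ (nb G v).card ∧
      m ≤ (missed G (c.A G) (sel (nb G r)) v).card ∧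
      ¬ ∃ g, IsMatched G r (c.A G) (c.ρ G) (sel (nb G r)) v g} ≤
      Fintype.card V * (18 * ((Fintype.card V : ℝ)⁻¹) ^ 8) := by
  classical
  let Q : (Finset V → Finset V) → (Finset V → Finset V) → V → Finset V → Set (SimpleGraph V) :=
    fun tsel jsel v P => {G | c.IsGood a G ∧ sel (nb G r) ⊆ nb G r ∧ v ≠ r ∧ ¬ G.Adj r v ∧
      ∃ T ⊆ available G (c.A G) (c.ρ G) (sel (nb G r)) v,
        ∃ J ⊆ missed G (c.A G) (sel (nb G r)) v,
          T = tsel (available G (c.A G) (c.ρ G) (sel (nb G r)) v) ∧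
          J = jsel (missed G (c.A G) (sel (nb G r)) v) ∧
          2 * (P.card * m * a / 4) ≤ T.card * J.card * a ∧
          ∀ w ∈ T, w ≠ r ∧ ¬ G.Adj r w ∧ ∀ x ∈ J, ∀ b ∈ c.A G x, ¬ G.Adj w b}
  have hQ : ∀ tsel jsel v P, G(V, p).real (Q tsel jsel v P) ≤
      Real.exp (-(10 * Real.log (Fintype.card V) * P.card)) := by
    intro tsel jsel v P
    refine (c.prob_no_pairs_le p sel v tsel jsel (P.card * m * a / 4)).trans
      (Real.exp_le_exp.2 ?_)
    have h0 : (0 : ℝ) ≤ P.card := by positivity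
    nlinarith [mul_le_mul_of_nonneg_right hp h0]
  let E₁ : V → Finset V → Finset V → Set (SimpleGraph V) := fun v P R =>
    Q (fun F => F \ R) (fun M => M ∩ P) v P
  let E₂ : V → Finset V → Finset V → Set (SimpleGraph V) := fun v P R =>
    Q (fun F => F ∩ P) (fun M => M \ R) v P
  refine le_trans ?_ (measureReal_exists_le G(V, p) (fun v =>
    {G | ∃ P R : Finset V, P.Nonempty ∧ R.card ≤ P.card ∧ G ∈ E₁ v P R} ∪
    {G | ∃ P R : Finset V, P.Nonempty ∧ R.card ≤ P.card ∧ G ∈ E₂ v P R}) fun v => ?_)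
  · refine MeasureTheory.measureReal_mono ?_
    rintro G ⟨hG, hsel, v, hvr, hrv, hcard, hmiss, hno⟩
    obtain ⟨T, hT, J, hJ, P, R, hP, hR, hPTJ, hTJ, h⟩ :=
      exists_obstruction_of_not_isMatched hrv hcard hno
    have hPTJ' : (P.card : ℝ) * (missed G (c.A G) (sel (nb G r)) v).card ≤
        2 * (T.card * J.card) := by exact_mod_cast hPTJ
    have hq : 2 * (P.card * m * a / 4) ≤ (T.card : ℝ) * J.card * a := by
      have h0 : (0 : ℝ) ≤ P.card := by positivity
      have h1 : (0 : ℝ) ≤ a := by positivity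
      have h2 := mul_le_mul_of_nonneg_left hmiss h0
      have h3 := mul_le_mul_of_nonneg_right (h2.trans hPTJ') h1
      linarith
    rcases hTJ with ⟨h1, h2⟩ | ⟨h1, h2⟩
    · exact ⟨v, Or.inl ⟨P, R, hP, hR, hG, hsel, hvr, hrv, T, hT, J, hJ, h1, h2, hq, h⟩⟩
    · exact ⟨v, Or.inr ⟨P, R, hP, hR, hG, hsel, hvr, hrv, T, hT, J, hJ, h1, h2, hq, h⟩⟩
  · refine (MeasureTheory.measureReal_union_le _ _).trans ?_
    have h1 := measureReal_exists_pair_le G(V, p) (E₁ v) fun P R _ _ =>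
      hQ (fun F => F \ R) (fun M => M ∩ P) v P
    have h2 := measureReal_exists_pair_le G(V, p) (E₂ v) fun P R _ _ =>
      hQ (fun F => F ∩ P) (fun M => M \ R) v P
    linarith

/-- Each core that v hits contains a neighbour of v in Z, and these are distinct because the cores
are disjoint. -/
lemma card_le_card_missed_add {V : Type*} [Fintype V] [DecidableEq V] {G : SimpleGraph V} {r : V}
    {A : V → Finset V} {ρ : V → ℕ} (hA : IsRooted G r A ρ) {X : Finset V} (hX : X ⊆ nb G r)
    {Z : Finset V} (hZ : ∀ x ∈ X, A x ⊆ Z) (v : V) :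
    X.card ≤ (missed G A X v).card + (nb G v ∩ Z).card := by
  classical
  have h1 := Finset.card_filter_add_card_filter_not (s := X) fun x => ∀ w ∈ A x, ¬ G.Adj v w
  have h2 : (X.filter fun x => ¬ ∀ w ∈ A x, ¬ G.Adj v w).card ≤ (nb G v ∩ Z).card := by
    have hex : ∀ x ∈ X.filter fun x => ¬ ∀ w ∈ A x, ¬ G.Adj v w, ∃ w, w ∈ A x ∧ G.Adj v w := by
      intro x hx
      have := (Finset.mem_filter.1 hx).2
      push Not at this
      exact this
    have : Nonempty V := ⟨r⟩
    choose! f hf using hex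
    refine Finset.card_le_card_of_injOn f (fun x hx => ?_) ?_
    · have hxX := (Finset.mem_filter.1 hx).1
      simp only [Finset.coe_inter, Set.mem_inter_iff, Finset.mem_coe, mem_nb]
      exact ⟨(hf x hx).2, hZ x hxX (hf x hx).1⟩
    · intro x hx y hy heq
      by_contra hne
      have hxr := mem_nb.1 (hX (Finset.mem_filter.1 hx).1)
      have hyr := mem_nb.1 (hX (Finset.mem_filter.1 hy).1)
      exact Finset.disjoint_left.1 (hA.disj x y hxr hyr hne) (hf x hx).1 (heq ▸ (hf y hy).1)
  have h3 : (missed G A X v).card = (X.filter fun x => ∀ w ∈ A x, ¬ G.Adj v w).card := by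
    rw [missed]
    congr!
  omega

/-! ### Singletons as cores -/

open Classical in
/-- The choice `A x = {x}`. -/
noncomputable def singletonCore (V : Type*) [Fintype V] (r : V) : CoreChoice V r where
  A _ x := {x}
  ρ _ _ := 0
  D G := (nb G r ×ˢ (insert r (nb G r))ᶜ).image fun x => s(x.1, x.2)
  congr G G' h := by
    have hnb : nb G' r = nb G r := by
      refine nb_eq_of_agree h fun w hw => ?_
      obtain ⟨⟨x, y⟩, hxy, heq⟩ := Finset.mem_image.1 hw
      simp only [Finset.mem_product, mem_nb, Finset.mem_compl, Finset.mem_insert, not_or] at hxy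
      rw [Sym2.eq_iff] at heq
      rcases heq with ⟨h1, -⟩ | ⟨-, h1⟩
      · exact hxy.1.ne h1.symm
      · exact hxy.2.1 h1
    exact ⟨hnb, rfl, rfl, by rw [hnb]⟩

lemma singletonCore_isGood {V : Type*} [Fintype V] (r : V) (G : SimpleGraph V) :
    (singletonCore V r).IsGood 1 G := by
  classical
  refine ⟨⟨?_, ?_, ?_, ?_⟩, ?_⟩
  · simp [singletonCore]
  · intro x y _ _ hxy
    simpa [singletonCore] using hxy
  · intro x hx
    simpa [singletonCore] using hx.ne
  · intro x _ u hu hux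
    simp only [singletonCore, Finset.mem_singleton] at hu
    exact absurd hu hux
  · intro x hx w hwr hrw _
    refine Finset.card_pos.2 ⟨x, Finset.mem_filter.2 ⟨by simp [singletonCore], ?_⟩⟩
    refine Finset.mem_image.2 ⟨(x, w), ?_, Sym2.eq_swap⟩
    simp [hx, hwr, hrw]

/-! ### Cores made of segments -/

lemma exists_descending_of_connected {V : Type*} {G : SimpleGraph V} {B : Finset V}
    (hB : (G.induce (B : Set V)).Connected) {b : V} (hb : b ∈ B) :
    ∃ ρ : V → ℕ, ∀ u ∈ B, u ≠ b → ∃ w ∈ B, G.Adj u w ∧ ρ w < ρ u := by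
  classical
  let b' : (B : Set V) := ⟨b, hb⟩
  refine ⟨fun u => if hu : u ∈ B then (G.induce (B : Set V)).dist ⟨u, hu⟩ b' else 0, ?_⟩
  intro u hu hub
  obtain ⟨W, hW⟩ := (hB.preconnected ⟨u, hu⟩ b').exists_walk_length_eq_dist
  have hnil : ¬ W.Nil := fun h => hub (congrArg Subtype.val h.eq)
  refine ⟨W.snd, W.snd.2, by simpa using W.adj_snd hnil, ?_⟩
  simp only [dif_pos hu, dif_pos (show (W.snd : V) ∈ B from W.snd.2)]
  have h1 := SimpleGraph.dist_le W.tail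
  have h2 := SimpleGraph.Walk.length_tail_add_one hnil
  rw [← hW]
  change (G.induce (B : Set V)).dist W.snd b' < _
  omega

open Classical in
/-- The pairs that meet neither `r` nor its neighbours and are not contained in one of the `U i`. -/
noncomputable def crossPairs {V : Type*} [Fintype V] (U : Fin 3 → Finset V) (r : V)
    (G : SimpleGraph V) : Finset (Sym2 V) :=
  Finset.univ.filter fun e => (∀ u ∈ e, u ≠ r ∧ u ∉ nb G r) ∧ ∀ i, ¬ ∀ u ∈ e, u ∈ U i

lemma mk_mem_crossPairs {V : Type*} [Fintype V] {U : Fin 3 → Finset V} {r : V}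
    {G : SimpleGraph V} {u w : V} : s(u, w) ∈ crossPairs U r G ↔
      ((u ≠ r ∧ ¬ G.Adj r u) ∧ (w ≠ r ∧ ¬ G.Adj r w)) ∧ ∀ i, ¬ (u ∈ U i ∧ w ∈ U i) := by
  simp [crossPairs]

/-- The graph without the edges among the `crossPairs`. -/
noncomputable def withoutCross {V : Type*} [Fintype V] (U : Fin 3 → Finset V) (r : V)
    (G : SimpleGraph V) : SimpleGraph V where
  Adj u w := G.Adj u w ∧ s(u, w) ∉ crossPairs U r G
  symm := ⟨fun u w h => ⟨h.1.symm, by rw [Sym2.eq_swap]; exact h.2⟩⟩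
  loopless := ⟨fun _ h => G.loopless.irrefl _ h.1⟩

lemma withoutCross_adj_root {V : Type*} [Fintype V] {U : Fin 3 → Finset V} {r : V}
    {G : SimpleGraph V} {x : V} : (withoutCross U r G).Adj r x ↔ G.Adj r x := by
  simp [withoutCross, mk_mem_crossPairs]

open Classical in
/-- A rooted family whose sets have many vertices outside of each `U i`. -/
structure IsSegmentCore {V : Type*} (U : Fin 3 → Finset V) (a : ℕ) (H : SimpleGraph V) (r : V)
    (c : (V → Finset V) × (V → ℕ)) : Prop where
  isRooted : IsRooted H r c.1 c.2
  le_card : ∀ x, H.Adj r x → ∀ i, a ≤ ((c.1 x).filter fun b => b ≠ x ∧ b ∉ U i).card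
  subset : ∀ x, H.Adj r x → c.1 x ⊆ insert x (Finset.univ.biUnion U)

open Classical in
/-- A choice of a family as in `IsSegmentCore` in the graph without the `crossPairs`. -/
noncomputable def segmentCoreFamily {V : Type*} (U : Fin 3 → Finset V) (a : ℕ) (r : V)
    (H : SimpleGraph V) : (V → Finset V) × (V → ℕ) :=
  if h : ∃ c, IsSegmentCore U a H r c then h.choose else (fun _ => ∅, fun _ => 0)

lemma withoutCross_congr {V : Type*} [Fintype V] {U : Fin 3 → Finset V} {r : V}
    {G G' : SimpleGraph V}
    (h : ∀ e ∉ crossPairs U r G, e ∈ G.edgeSet ↔ e ∈ G'.edgeSet) :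
    nb G' r = nb G r ∧ crossPairs U r G' = crossPairs U r G ∧
      withoutCross U r G' = withoutCross U r G := by
  have h1 : nb G' r = nb G r := nb_eq_of_agree h fun w hw => (mk_mem_crossPairs.1 hw).1.1.1 rfl
  have h2 : crossPairs U r G' = crossPairs U r G := by
    unfold crossPairs
    rw [h1]
  refine ⟨h1, h2, ?_⟩
  ext u w
  change G'.Adj u w ∧ s(u, w) ∉ crossPairs U r G' ↔ G.Adj u w ∧ s(u, w) ∉ crossPairs U r G
  rw [h2]
  exact and_congr_left fun hn => (adj_iff_of_agree h hn).symm

/-- The choice of a family as in `IsSegmentCore`. -/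
noncomputable def segmentCore {V : Type*} [Fintype V] (U : Fin 3 → Finset V) (a : ℕ) (r : V) :
    CoreChoice V r where
  A G := (segmentCoreFamily U a r (withoutCross U r G)).1
  ρ G := (segmentCoreFamily U a r (withoutCross U r G)).2
  D G := crossPairs U r G
  congr G G' h := by
    obtain ⟨h1, h2, h3⟩ := withoutCross_congr h
    exact ⟨h1, by rw [h3], by rw [h3], h2⟩

lemma isSegmentCore_segmentCoreFamily {V : Type*} {U : Fin 3 → Finset V} {a : ℕ} {r : V}
    {H : SimpleGraph V} (h : ∃ c, IsSegmentCore U a H r c) :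
    IsSegmentCore U a H r (segmentCoreFamily U a r H) := by
  rw [segmentCoreFamily, dif_pos h]
  exact h.choose_spec

/-- A vertex w lies in at most one reservoir, so the core vertices outside that reservoir form cross
pairs with w. They are not neighbours of r, since every neighbour of r lies in its own core. -/
lemma segmentCore_isGood {V : Type*} [Fintype V] {U : Fin 3 → Finset V}
    (hU : ∀ i j, i ≠ j → Disjoint (U i) (U j)) {a : ℕ} {r : V} {G : SimpleGraph V}
    (h : ∃ c, IsSegmentCore U a (withoutCross U r G) r c) : (segmentCore U a r).IsGood a G := by
  classical
  have hc := isSegmentCore_segmentCoreFamily h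
  refine ⟨⟨?_, ?_, ?_, ?_⟩, ?_⟩
  · exact fun x hx => hc.isRooted.self_mem x (withoutCross_adj_root.2 hx)
  · exact fun x y hx hy => hc.isRooted.disj x y (withoutCross_adj_root.2 hx)
      (withoutCross_adj_root.2 hy)
  · exact fun x hx => hc.isRooted.root_notMem x (withoutCross_adj_root.2 hx)
  · intro x hx u hu hux
    obtain ⟨w, hw, huw, hlt⟩ := hc.isRooted.descend x (withoutCross_adj_root.2 hx) u hu hux
    exact ⟨w, hw, huw.1, hlt⟩
  · intro x hx w hwr hrw hwA
    have hx' := withoutCross_adj_root (U := U).2 hx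
    obtain ⟨i, hi⟩ : ∃ i, ∀ j, w ∈ U j → j = i := by
      by_cases hw : ∃ i, w ∈ U i
      · obtain ⟨i, hi⟩ := hw
        refine ⟨i, fun j hj => ?_⟩
        by_contra hne
        exact Finset.disjoint_left.1 (hU j i hne) hj hi
      · exact ⟨0, fun j hj => absurd ⟨j, hj⟩ hw⟩
    refine (hc.le_card x hx' i).trans (Finset.card_le_card ?_)
    intro b hb
    obtain ⟨hbA, hbx, hbU⟩ := Finset.mem_filter.1 hb
    refine Finset.mem_filter.2 ⟨hbA, mk_mem_crossPairs.2 ⟨⟨⟨hwr, hrw⟩, ?_, ?_⟩, ?_⟩⟩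
    · rintro rfl
      exact hc.isRooted.root_notMem x hx' hbA
    · intro hrb
      have hrb' := withoutCross_adj_root (U := U).2 hrb
      exact Finset.disjoint_left.1 (hc.isRooted.disj b x hrb' hx' hbx)
        (hc.isRooted.self_mem b hrb') hbA
    · rintro j ⟨hwj, hbj⟩
      exact hbU (hi j hwj ▸ hbj)

lemma segmentCore_subset {V : Type*} [Fintype V] [DecidableEq V] {U : Fin 3 → Finset V} {a : ℕ}
    {r : V} {G : SimpleGraph V} (h : ∃ c, IsSegmentCore U a (withoutCross U r G) r c) {x : V}
    (hx : G.Adj r x) : (segmentCore U a r).A G x ⊆ insert x (Finset.univ.biUnion U) := by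
  have := (isSegmentCore_segmentCoreFamily h).subset x (withoutCross_adj_root.2 hx)
  intro y hy
  have := this hy
  simp only [Finset.mem_insert, Finset.mem_biUnion] at this ⊢
  exact this

/-- A x consists of x and the segments matched to it in the reservoirs not containing x. Its
connecting edges lie inside a reservoir or meet x, so they survive in `withoutCross`. -/
theorem exists_isSegmentCore {V : Type*} [Fintype V] {U : Fin 3 → Finset V}
    (hU : ∀ i j, i ≠ j → Disjoint (U i) (U j)) {a M : ℕ} {r : V} {G : SimpleGraph V}
    {𝓑 : Fin 3 → Finset (Finset V)} (hseg : ∀ i, IsSegments G (U i) a M (𝓑 i))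
    (hmatch : ∀ i, HasSegmentMatching G r (U i) (𝓑 i)) :
    ∃ c, IsSegmentCore U a (withoutCross U r G) r c := by
  classical
  choose f hf hinj using hmatch
  have hfB : ∀ i x, G.Adj r x → x ∉ U i → f i x ∈ 𝓑 i := fun i x hx hxU => (hf i x hx hxU).1
  have hfr : ∀ i x, G.Adj r x → x ∉ U i → r ∉ f i x := fun i x hx hxU => (hf i x hx hxU).2.1
  have hfn : ∀ i x, G.Adj r x → x ∉ U i → ∀ y ∈ f i x, ¬ G.Adj r y := fun i x hx hxU =>
    (hf i x hx hxU).2.2.1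
  have hfU : ∀ i x, G.Adj r x → x ∉ U i → f i x ⊆ U i := fun i x hx hxU =>
    (hseg i).subset _ (hfB i x hx hxU)
  have huniq : ∀ i j x y u, G.Adj r x → x ∉ U i → G.Adj r y → y ∉ U j → u ∈ f i x → u ∈ f j y →
      i = j ∧ x = y := by
    intro i j x y u hx hxU hy hyU hux huy
    have hij : i = j := by
      by_contra hne
      exact Finset.disjoint_left.1 (hU i j hne) (hfU i x hx hxU hux) (hfU j y hy hyU huy)
    subst hij
    refine ⟨rfl, hinj i x y hx hxU hy hyU ?_⟩
    by_contra hne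
    exact Finset.disjoint_left.1 ((hseg i).disj _ (hfB i x hx hxU) _ (hfB i y hy hyU) hne) hux huy
  have hρ : ∀ i x, ∃ ρ : V → ℕ, G.Adj r x → x ∉ U i → ∃ b ∈ f i x, G.Adj x b ∧
      ∀ u ∈ f i x, u ≠ b → ∃ w ∈ f i x, G.Adj u w ∧ ρ w < ρ u := by
    intro i x
    by_cases h : G.Adj r x ∧ x ∉ U i
    · obtain ⟨b, hb, hxb⟩ := (hf i x h.1 h.2).2.2.2
      obtain ⟨ρ, hρ⟩ := exists_descending_of_connected
        ((hseg i).connected _ (hfB i x h.1 h.2)) hb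
      exact ⟨ρ, fun _ _ => ⟨b, hb, hxb, hρ⟩⟩
    · exact ⟨fun _ => 0, fun h1 h2 => absurd ⟨h1, h2⟩ h⟩
  choose ρ₀ hρ₀ using hρ
  -- The shift by 1 places x, with value 0, below all segment vertices; disjointness makes the
  -- choice of segment unambiguous.
  let ρ : V → ℕ := fun u =>
    if h : ∃ y : Fin 3 × V, G.Adj r y.2 ∧ y.2 ∉ U y.1 ∧ u ∈ f y.1 y.2 then
      ρ₀ h.choose.1 h.choose.2 u + 1 else 0
  have hρf : ∀ i x u, G.Adj r x → x ∉ U i → u ∈ f i x → ρ u = ρ₀ i x u + 1 := by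
    intro i x u hx hxU hu
    have h : ∃ y : Fin 3 × V, G.Adj r y.2 ∧ y.2 ∉ U y.1 ∧ u ∈ f y.1 y.2 := ⟨(i, x), hx, hxU, hu⟩
    obtain ⟨h1, h2⟩ := huniq _ _ _ _ u h.choose_spec.1 h.choose_spec.2.1 hx hxU
      h.choose_spec.2.2 hu
    simp only [ρ, dif_pos h, h1, h2]
  have hρx : ∀ x, G.Adj r x → ρ x = 0 := by
    intro x hx
    refine dif_neg ?_
    rintro ⟨y, hy, hyU, hxy⟩
    exact hfn y.1 y.2 hy hyU x hxy hx
  let A : V → Finset V := fun x =>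
    insert x ((Finset.univ.filter fun i => x ∉ U i).biUnion fun i => f i x)
  have hA : ∀ x u, u ∈ A x ↔ u = x ∨ ∃ i, x ∉ U i ∧ u ∈ f i x := by
    intro x u
    simp [A]
  refine ⟨(A, ρ), ⟨?_, ?_, ?_, ?_⟩, ?_, ?_⟩
  · intro x _
    exact (hA x x).2 (Or.inl rfl)
  · intro x y hx hy hxy
    rw [withoutCross_adj_root] at hx hy
    refine Finset.disjoint_left.2 fun u hux huy => ?_
    rcases (hA x u).1 hux with rfl | ⟨i, hxU, hux⟩
    · rcases (hA y u).1 huy with h | ⟨j, hyU, huy⟩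
      · exact hxy h
      · exact hfn j y hy hyU _ huy hx
    · rcases (hA y u).1 huy with rfl | ⟨j, hyU, huy⟩
      · exact hfn i x hx hxU _ hux hy
      · exact hxy (huniq i j x y u hx hxU hy hyU hux huy).2
  · intro x hx hr
    rw [withoutCross_adj_root] at hx
    rcases (hA x r).1 hr with rfl | ⟨i, hxU, h⟩
    · exact G.loopless.irrefl _ hx
    · exact hfr i x hx hxU h
  · intro x hx u hu hux
    rw [withoutCross_adj_root] at hx
    rcases (hA x u).1 hu with rfl | ⟨i, hxU, hu⟩
    · exact absurd rfl hux
    obtain ⟨b, hb, hxb, hdesc⟩ := hρ₀ i x hx hxU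
    by_cases hub : u = b
    · subst hub
      refine ⟨x, (hA x x).2 (Or.inl rfl), ⟨hxb.symm, fun h => ?_⟩, ?_⟩
      · exact (mk_mem_crossPairs.1 h).1.2.2 hx
      · change ρ x < ρ u
        rw [hρx x hx, hρf i x u hx hxU hu]
        omega
    · obtain ⟨w, hw, huw, hlt⟩ := hdesc u hu hub
      refine ⟨w, (hA x w).2 (Or.inr ⟨i, hxU, hw⟩), ⟨huw, fun h => ?_⟩, ?_⟩
      · exact (mk_mem_crossPairs.1 h).2 i ⟨hfU i x hx hxU hu, hfU i x hx hxU hw⟩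
      · change ρ w < ρ u
        rw [hρf i x w hx hxU hw, hρf i x u hx hxU hu]
        omega
  · intro x hx j
    rw [withoutCross_adj_root] at hx
    -- Three reservoirs are needed here: one may contain x, another is the excluded j, and one is
    -- left.
    obtain ⟨i, hij, hxi⟩ : ∃ i, i ≠ j ∧ x ∉ U i := by
      by_contra! hall
      have hne1 : j + 1 ≠ j := (show ∀ j : Fin 3, j + 1 ≠ j by decide) j
      have hne2 : j + 2 ≠ j := (show ∀ j : Fin 3, j + 2 ≠ j by decide) j
      have hne3 : j + 1 ≠ j + 2 := (show ∀ j : Fin 3, j + 1 ≠ j + 2 by decide) j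
      exact Finset.disjoint_left.1 (hU _ _ hne3) (hall _ hne1) (hall _ hne2)
    rw [← (hseg i).card_eq _ (hfB i x hx hxi)]
    refine Finset.card_le_card fun u hu => Finset.mem_filter.2 ⟨?_, ?_, ?_⟩
    · exact (hA x u).2 (Or.inr ⟨i, hxi, hu⟩)
    · rintro rfl
      exact hfn i u hx hxi u hu hx
    · exact Finset.disjoint_left.1 (hU i j hij) (hfU i x hx hxi hu)
  · intro x hx u hu
    rw [withoutCross_adj_root] at hx
    rcases (hA x u).1 hu with rfl | ⟨i, hxU, hu⟩
    · exact Finset.mem_insert_self _ _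
    · exact Finset.mem_insert_of_mem
        (Finset.mem_biUnion.2 ⟨i, Finset.mem_univ _, hfU i x hx hxU hu⟩)

/-! ### Degrees -/

open Classical in
/-- The pairs that join `v` to the set `Z G`. -/
noncomputable def starPairs {V : Type*} (v : V) (Z : SimpleGraph V → Finset V)
    (G : SimpleGraph V) : Finset (Sym2 V) :=
  (Z G).image fun w => s(v, w)

lemma mem_starPairs {V : Type*} {v : V} {Z : SimpleGraph V → Finset V} {G : SimpleGraph V}
    {e : Sym2 V} : e ∈ starPairs v Z G ↔ ∃ w ∈ Z G, s(v, w) = e := by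
  simp [starPairs]

lemma card_starPairs {V : Type*} (v : V) (Z : SimpleGraph V → Finset V) (G : SimpleGraph V) :
    (starPairs v Z G).card = (Z G).card := by
  classical exact Finset.card_image_of_injective _ fun _ _ h => Sym2.congr_right.1 h

lemma card_edges_inter_starPairs {V : Type*} [Fintype V] [DecidableEq V] (v : V)
    (Z : SimpleGraph V → Finset V) (G : SimpleGraph V) :
    (edges G ∩ starPairs v Z G).card = (nb G v ∩ Z G).card := by
  rw [← Finset.card_image_of_injective (nb G v ∩ Z G) (f := fun w => s(v, w))
    fun _ _ h => Sym2.congr_right.1 h]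
  congr 1
  ext e
  simp only [starPairs, Finset.mem_inter, mem_edges, Finset.mem_image, mem_nb]
  constructor
  · rintro ⟨h1, w, hw, rfl⟩
    exact ⟨w, ⟨h1, hw⟩, rfl⟩
  · rintro ⟨w, ⟨h1, hw⟩, rfl⟩
    exact ⟨h1, w, hw, rfl⟩

lemma isFree_starPairs {V : Type*} {v : V} {Z : SimpleGraph V → Finset V} (hv : ∀ G, v ∉ Z G)
    (hZ : ∀ G G', (∀ e ∉ starPairs v Z G, e ∈ G.edgeSet ↔ e ∈ G'.edgeSet) → Z G' = Z G) :
    IsFree (starPairs v Z) := by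
  refine ⟨fun G e he hd => ?_, fun G G' h => ?_⟩
  · obtain ⟨w, hw, rfl⟩ := mem_starPairs.1 he
    rw [Sym2.mk_isDiag_iff] at hd
    exact hv G (hd ▸ hw)
  · rw [starPairs, starPairs, hZ G G' h]

lemma isFree_starPairs_const {V : Type*} {v : V} {Z : Finset V} (hv : v ∉ Z) :
    IsFree (starPairs v fun _ => Z) :=
  isFree_starPairs (fun _ => hv) fun _ _ _ => rfl

lemma nb_inter_erase {V : Type*} [Fintype V] [DecidableEq V] (G : SimpleGraph V) (v : V)
    (Z : Finset V) : nb G v ∩ Z.erase v = nb G v ∩ Z := by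
  ext w
  simp only [Finset.mem_inter, mem_nb, Finset.mem_erase]
  exact ⟨fun h => ⟨h.1, h.2.2⟩, fun h => ⟨h.1, h.1.ne', h.2⟩⟩

lemma prob_exists_card_nb_inter_ge {V : Type*} [Fintype V] [DecidableEq V] (p : I) {ε u : ℝ}
    (hε0 : 0 < ε) (hε1 : ε ≤ 1) (hu0 : 0 ≤ u) {Z : Finset V} (hu : (p : ℝ) * Z.card ≤ u) :
    G(V, p).real {G | ∃ v, (1 + ε) * u ≤ (nb G v ∩ Z).card} ≤
      Fintype.card V * Real.exp (-(ε ^ 2 * u / 8)) := by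
  refine measureReal_exists_le _ (fun v => {G | (1 + ε) * u ≤ (nb G v ∩ Z).card}) fun v => ?_
  refine (isFree_starPairs_const (Finset.notMem_erase v Z)).prob_upper_le p hε0 hε1 hu0 ?_
  intro G hG
  rw [card_edges_inter_starPairs, nb_inter_erase, card_starPairs]
  refine ⟨le_trans (mul_le_mul_of_nonneg_left ?_ p.2.1) hu, hG⟩
  exact_mod_cast Finset.card_le_card (Finset.erase_subset v Z)

lemma prob_exists_card_nb_le {V : Type*} [Fintype V] (p : I) {ε : ℝ}
    (hε0 : 0 < ε) (hε1 : ε ≤ 1) :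
    G(V, p).real {G | ∃ v, ((nb G v).card : ℝ) ≤ (1 - ε) * (p * (Fintype.card V - 1))} ≤
      Fintype.card V * Real.exp (-(ε ^ 2 * (p * (Fintype.card V - 1)) / 8)) := by
  classical
  refine measureReal_exists_le _ (fun v =>
    {G | ((nb G v).card : ℝ) ≤ (1 - ε) * (p * (Fintype.card V - 1))}) fun v => ?_
  have h1 : (1 : ℝ) ≤ Fintype.card V := by exact_mod_cast Fintype.card_pos_iff.2 ⟨v⟩
  refine (isFree_starPairs_const (Finset.notMem_erase v Finset.univ)).prob_lower_le p hε0 hε1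
    (mul_nonneg p.2.1 (by linarith)) ?_
  intro G hG
  rw [card_edges_inter_starPairs, nb_inter_erase, card_starPairs, Finset.inter_univ,
    Finset.card_erase_of_mem (Finset.mem_univ v), Finset.card_univ,
    Nat.cast_sub (Fintype.card_pos_iff.2 ⟨v⟩), Nat.cast_one]
  exact ⟨le_rfl, hG⟩

/-- The neighbourhood of r is exposed first. For v ≠ r the pairs from v into it do not meet r, so
they remain free. -/
lemma prob_exists_card_nb_inter_nb_ge {V : Type*} [Fintype V] [DecidableEq V] (p : I) {ε u : ℝ}
    (hε0 : 0 < ε) (hε1 : ε ≤ 1) (hu0 : 0 ≤ u) :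
    G(V, p).real {G | ∃ r v, v ≠ r ∧ (p : ℝ) * (nb G r).card ≤ u ∧
      (1 + ε) * u ≤ (nb G v ∩ nb G r).card} ≤
      Fintype.card V * (Fintype.card V * Real.exp (-(ε ^ 2 * u / 8))) := by
  refine measureReal_exists_le _ (fun r => {G | ∃ v, v ≠ r ∧ (p : ℝ) * (nb G r).card ≤ u ∧
      (1 + ε) * u ≤ (nb G v ∩ nb G r).card}) fun r => ?_
  refine measureReal_exists_le _ (fun v => {G | v ≠ r ∧ (p : ℝ) * (nb G r).card ≤ u ∧
      (1 + ε) * u ≤ (nb G v ∩ nb G r).card}) fun v => ?_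
  by_cases hvr : v = r
  · simp only [hvr, ne_eq, not_true_eq_false, false_and, Set.ofPred_false,
      MeasureTheory.measureReal_empty]
    exact (Real.exp_pos _).le
  have hfree : IsFree (starPairs v fun G => (nb G r).erase v) := by
    refine isFree_starPairs (fun G => Finset.notMem_erase v _) fun G G' h => ?_
    have : nb G' r = nb G r := by
      refine nb_eq_of_agree h fun w hw => ?_
      obtain ⟨x, hx, heq⟩ := mem_starPairs.1 hw
      rw [Sym2.eq_iff] at heq
      rcases heq with ⟨h1, -⟩ | ⟨-, h1⟩
      · exact hvr h1
      · subst h1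
        simp at hx
    rw [this]
  refine hfree.prob_upper_le p hε0 hε1 hu0 ?_
  rintro G ⟨-, h1, h2⟩
  rw [card_edges_inter_starPairs, nb_inter_erase, card_starPairs]
  refine ⟨le_trans (mul_le_mul_of_nonneg_left ?_ p.2.1) h1, h2⟩
  exact_mod_cast Finset.card_le_card (Finset.erase_subset v _)

/-! ### From good cores to independent spanning trees -/

open Classical in
/-- A subset with `k` elements, if there is one. -/
noncomputable def chooseSubset {V : Type*} (k : ℕ) (N : Finset V) : Finset V :=
  if h : k ≤ N.card then (Finset.exists_subset_card_eq h).choose else ∅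

lemma chooseSubset_subset {V : Type*} (k : ℕ) (N : Finset V) : chooseSubset k N ⊆ N := by
  unfold chooseSubset
  split_ifs with h
  · exact (Finset.exists_subset_card_eq h).choose_spec.1
  · simp

lemma card_chooseSubset {V : Type*} {k : ℕ} {N : Finset V} (h : k ≤ N.card) :
    (chooseSubset k N).card = k := by
  rw [chooseSubset, dif_pos h]
  exact (Finset.exists_subset_card_eq h).choose_spec.2

/-- The minimum degree depends on the whole graph, so it cannot be used in an adaptive choice of X.
The union bound instead runs over its fewer than n possible values k, with X a k-subset determined
by the neighbourhood of r. -/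
theorem prob_not_hasISTs_le {V : Type*} [Fintype V] [Nonempty V] (p : I)
    (c : ∀ r : V, CoreChoice V r) {a : ℕ} {m : ℝ}
    (hp : 40 * Real.log (Fintype.card V) ≤ p * (a * m)) (ℰ : Set (SimpleGraph V))
    (hℰ : ∀ G ∈ ℰ, ∀ r, (c r).IsGood a G ∧ (∃ v, v ≠ r ∧ ¬ G.Adj r v) ∧
      ∀ X ⊆ nb G r, X.card = minDeg G → ∀ v, v ≠ r → ¬ G.Adj r v →
        m ≤ (missed G ((c r).A G) X v).card) :
    G(V, p).real {G | G ∈ ℰ ∧ ¬ ∀ r, HasISTs G r (minDeg G)} ≤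
      Fintype.card V * (Fintype.card V *
        (Fintype.card V * (18 * ((Fintype.card V : ℝ)⁻¹) ^ 8))) := by
  let E : V → ℕ → Set (SimpleGraph V) := fun r k =>
    {G | (c r).IsGood a G ∧ chooseSubset k (nb G r) ⊆ nb G r ∧ ∃ v, v ≠ r ∧ ¬ G.Adj r v ∧
      (chooseSubset k (nb G r)).card ≤ (nb G v).card ∧
      m ≤ (missed G ((c r).A G) (chooseSubset k (nb G r)) v).card ∧
      ¬ ∃ g, IsMatched G r ((c r).A G) ((c r).ρ G) (chooseSubset k (nb G r)) v g}
  have hE : ∀ r (k : Fin (Fintype.card V)), G(V, p).real (E r k) ≤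
      Fintype.card V * (18 * ((Fintype.card V : ℝ)⁻¹) ^ 8) := fun r k =>
    (c r).prob_not_isMatched_le p hp (chooseSubset k)
  have hE' : ∀ r, G(V, p).real {G | ∃ k : Fin (Fintype.card V), G ∈ E r k} ≤
      Fintype.card V * (Fintype.card V * (18 * ((Fintype.card V : ℝ)⁻¹) ^ 8)) := fun r => by
    have := measureReal_exists_le G(V, p) (fun k : Fin (Fintype.card V) => E r k) (hE r)
    rwa [Fintype.card_fin] at this
  refine le_trans ?_ (measureReal_exists_le G(V, p) _ hE')
  refine MeasureTheory.measureReal_mono ?_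
  rintro G ⟨hG, hno⟩
  push Not at hno
  obtain ⟨r, hr⟩ := hno
  have hk : minDeg G < Fintype.card V := (minDeg_le_card_nb G r).trans_lt (card_nb_lt G r)
  refine ⟨r, ⟨minDeg G, hk⟩, ?_⟩
  obtain ⟨hgood, ⟨v₀, hv₀, hrv₀⟩, hmiss⟩ := hℰ G hG r
  have hsub := chooseSubset_subset (minDeg G) (nb G r)
  have hcard := card_chooseSubset (minDeg_le_card_nb G r)
  by_contra hnot
  have hall : ∀ v, v ≠ r → ¬ G.Adj r v → ∃ g, IsMatched G r ((c r).A G) ((c r).ρ G)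
      (chooseSubset (minDeg G) (nb G r)) v g := by
    intro v hv hrv
    by_contra hg
    exact hnot ⟨hgood, hsub, v, hv, hrv, by rw [hcard]; exact minDeg_le_card_nb G v,
      hmiss _ hsub hcard v hv hrv, hg⟩
  have : Nonempty V := ⟨r⟩
  choose! g hg using hall
  have := hasISTs_of_isMatched hgood.isRooted (X := chooseSubset (minDeg G) (nb G r))
    (fun x hx => mem_nb.1 (hsub hx)) hv₀ hrv₀ hg
  rw [hcard] at this
  exact hr this

/-! ### Near-regularity and the two density regimes -/

lemma exp_neg_le_inv_pow {n x : ℝ} (hn : 0 < n) (hx : 4 * Real.log n ≤ x) :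
    Real.exp (-x) ≤ (n⁻¹) ^ 4 := by
  calc Real.exp (-x) ≤ Real.exp ((4 : ℕ) * (-Real.log n)) :=
        Real.exp_le_exp.2 (by push_cast; linarith)
    _ = (n⁻¹) ^ 4 := by rw [Real.exp_nat_mul, Real.exp_neg, Real.exp_log hn]

/-- All degrees of `G` are close to their expectation. -/
def NearlyRegular {V : Type*} [Fintype V] (p : ℝ) (G : SimpleGraph V) : Prop :=
  ∀ v, ((nb G v).card : ℝ) < 1.001 * (p * Fintype.card V) ∧
    0.999 * (p * (Fintype.card V - 1)) < ((nb G v).card : ℝ)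

lemma prob_not_nearlyRegular_le {V : Type*} [Fintype V] (p : I) (hn : 2 ≤ Fintype.card V)
    (hp : 10 ^ 8 * Real.log (Fintype.card V) ≤ p * Fintype.card V) :
    G(V, p).real {G | ¬ NearlyRegular p G} ≤ 2 * (Fintype.card V : ℝ)⁻¹ := by
  classical
  set n : ℝ := (Fintype.card V : ℝ) with hnd
  have hn2 : (2 : ℝ) ≤ n := by rw [hnd]; exact_mod_cast hn
  have hn0 : 0 < n := by linarith
  have hp0 : (0 : ℝ) ≤ p := p.2.1
  have h1 := prob_exists_card_nb_inter_ge p (ε := 1 / 1000) (u := p * n) (Z := (Finset.univ : Finset V))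
    (by norm_num) (by norm_num) (by positivity) (by rw [Finset.card_univ])
  have h2 := prob_exists_card_nb_le (V := V) p (ε := 1 / 1000) (by norm_num) (by norm_num)
  have h3 : Real.exp (-((1 / 1000) ^ 2 * (p * n) / 8)) ≤ (n⁻¹) ^ 4 :=
    exp_neg_le_inv_pow hn0 (by
      have := Real.log_nonneg (by linarith : (1 : ℝ) ≤ n)
      linarith)
  have h4 : Real.exp (-((1 / 1000) ^ 2 * (p * (n - 1)) / 8)) ≤ (n⁻¹) ^ 4 :=
    exp_neg_le_inv_pow hn0 (by
      have := Real.log_nonneg (by linarith : (1 : ℝ) ≤ n)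
      have : (p : ℝ) * n ≤ 2 * (p * (n - 1)) := by nlinarith
      linarith)
  have h5 : n * (n⁻¹) ^ 4 ≤ n⁻¹ := by
    have h6 : n⁻¹ ≤ 1 := inv_le_one_of_one_le₀ (by linarith)
    have h7 : (0 : ℝ) ≤ n⁻¹ := by positivity
    calc n * (n⁻¹) ^ 4 = (n * n⁻¹) * (n⁻¹) ^ 3 := by ring
      _ = (n⁻¹) ^ 3 := by rw [mul_inv_cancel₀ hn0.ne', one_mul]
      _ ≤ (n⁻¹) ^ 1 := pow_le_pow_of_le_one h7 h6 (by norm_num)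
      _ = n⁻¹ := pow_one _
  have hsub : {G : SimpleGraph V | ¬ NearlyRegular p G} ⊆
      {G | ∃ v, (1 + 1 / 1000) * (p * n) ≤ ((nb G v ∩ Finset.univ).card : ℝ)} ∪
      {G | ∃ v, ((nb G v).card : ℝ) ≤ (1 - 1 / 1000) * (p * (n - 1))} := by
    intro G hG
    by_contra hcon
    simp only [Set.mem_union, Set.mem_ofPred_eq, Finset.inter_univ, not_or, not_exists,
      not_le] at hcon
    apply hG
    intro v
    have h6 := hcon.1 v
    have h7 := hcon.2 v
    constructor
    · norm_num at h6 ⊢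
      exact h6
    · norm_num at h7 ⊢
      exact h7
  have h6 := MeasureTheory.measureReal_mono (μ := G(V, p)) hsub
  have h7 := MeasureTheory.measureReal_union_le (μ := G(V, p))
    {G | ∃ v, (1 + 1 / 1000) * (p * n) ≤ ((nb G v ∩ Finset.univ).card : ℝ)}
    {G | ∃ v, ((nb G v).card : ℝ) ≤ (1 - 1 / 1000) * (p * (n - 1))}
  have h8 := mul_le_mul_of_nonneg_left h3 hn0.le
  have h9 := mul_le_mul_of_nonneg_left h4 hn0.le
  linarith

lemma NearlyRegular.exists_not_adj {V : Type*} [Fintype V] {p : ℝ} {G : SimpleGraph V}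
    (hG : NearlyRegular p G) (hp : p ≤ 0.99) (hn : 1000 ≤ Fintype.card V) (r : V) :
    ∃ v, v ≠ r ∧ ¬ G.Adj r v := by
  classical
  by_contra! hall
  have h1 : (Finset.univ : Finset V) ⊆ insert r (nb G r) := fun v _ => by
    rw [Finset.mem_insert, mem_nb]
    by_cases h : v = r
    · exact Or.inl h
    · exact Or.inr (hall v h)
  have h2 := (Finset.card_le_card h1).trans (Finset.card_insert_le _ _)
  rw [Finset.card_univ] at h2
  have h3 : (Fintype.card V : ℝ) ≤ (nb G r).card + 1 := by exact_mod_cast h2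
  have h4 := (hG r).1
  have h5 : (1000 : ℝ) ≤ Fintype.card V := by exact_mod_cast hn
  nlinarith

lemma NearlyRegular.lt_minDeg {V : Type*} [Fintype V] [Nonempty V] {p : ℝ} {G : SimpleGraph V}
    (hG : NearlyRegular p G) : 0.999 * (p * (Fintype.card V - 1)) < (minDeg G : ℝ) := by
  obtain ⟨v, hv⟩ := exists_card_nb_eq_minDeg G
  rw [← hv]
  exact (hG v).2

lemma mul_inv_pow_le {n : ℝ} (hn : 1 ≤ n) :
    n * (n * (n⁻¹) ^ 4) ≤ n⁻¹ ∧ n * (n * (n * (18 * (n⁻¹) ^ 8))) ≤ 18 * n⁻¹ ∧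
      n * (9 * (n⁻¹) ^ 8) ≤ 9 * n⁻¹ ∧ 9 * (n⁻¹) ^ 8 ≤ 9 * n⁻¹ ∧ n * (n⁻¹) ^ 4 ≤ n⁻¹ := by
  have hn0 : 0 < n := by linarith
  obtain ⟨x, hx⟩ : ∃ x, x = n⁻¹ := ⟨_, rfl⟩
  have hnx : n * x = 1 := by rw [hx]; exact mul_inv_cancel₀ hn0.ne'
  have h1 : x ≤ 1 := by rw [hx]; exact inv_le_one_of_one_le₀ hn
  have h0 : 0 ≤ x := by rw [hx]; positivity
  have key : ∀ k : ℕ, x ^ (k + 1) ≤ x := fun k => by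
    calc x ^ (k + 1) ≤ x ^ 1 := pow_le_pow_of_le_one h0 h1 (by omega)
      _ = x := pow_one x
  rw [← hx]
  refine ⟨?_, ?_, ?_, ?_, ?_⟩
  · calc n * (n * x ^ 4) = (n * x) * (n * x) * x ^ 2 := by ring
      _ ≤ x := by rw [hnx, one_mul, one_mul]; exact key 1
  · calc n * (n * (n * (18 * x ^ 8))) = (n * x) * (n * x) * (n * x) * (18 * x ^ 5) := by ring
      _ ≤ 18 * x := by rw [hnx]; linarith [show x ^ 5 ≤ x from key 4]
  · calc n * (9 * x ^ 8) = (n * x) * (9 * x ^ 7) := by ring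
      _ ≤ 9 * x := by rw [hnx]; linarith [show x ^ 7 ≤ x from key 6]
  · linarith [show x ^ 8 ≤ x from key 7]
  · calc n * x ^ 4 = (n * x) * x ^ 3 := by ring
      _ ≤ x := by rw [hnx]; linarith [show x ^ 3 ≤ x from key 2]

/-- With singleton cores, v misses at least δ(G) minus its codegree with r. The codegree is at most
about p²n ≤ 0.99 pn, leaving at least pn/200 missed cores, and a = 1 suffices. -/
theorem prob_not_hasISTs_le_of_dense {V : Type*} [Fintype V] (p : I)
    (hn : 1000 ≤ Fintype.card V) (hp1 : (p : ℝ) ≤ 0.99)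
    (hp : 10 ^ 8 * Real.log (Fintype.card V) ≤ p * (p * Fintype.card V)) :
    G(V, p).real {G | ¬ ∀ r, HasISTs G r (minDeg G)} ≤ 100 * (Fintype.card V : ℝ)⁻¹ := by
  classical
  have hne : Nonempty V := Fintype.card_pos_iff.1 (by omega)
  set n : ℝ := (Fintype.card V : ℝ) with hnd
  have hn1 : (1000 : ℝ) ≤ n := by rw [hnd]; exact_mod_cast hn
  have hn0 : 0 < n := by linarith
  have hp0 : (0 : ℝ) ≤ p := p.2.1
  have hL : 0 ≤ Real.log n := Real.log_nonneg (by linarith)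
  have hpn : (p : ℝ) * (p * n) ≤ p * n := by
    have : 0 ≤ (p : ℝ) * n := by positivity
    nlinarith
  have h1 := prob_not_nearlyRegular_le p (by omega) (hp.trans hpn)
  set u : ℝ := 1.001 * (p * (p * n)) with hu
  have hu0 : 0 ≤ u := by positivity
  have h2 := prob_exists_card_nb_inter_nb_ge (V := V) p (ε := 1 / 1000) (u := u) (by norm_num)
    (by norm_num) hu0
  have h3 : Real.exp (-((1 / 1000) ^ 2 * u / 8)) ≤ (n⁻¹) ^ 4 :=
    exp_neg_le_inv_pow hn0 (by rw [hu]; linarith)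
  let ℰ : Set (SimpleGraph V) := {G | NearlyRegular p G ∧ ¬ ∃ r v, v ≠ r ∧
    (p : ℝ) * (nb G r).card ≤ u ∧ (1 + 1 / 1000) * u ≤ ((nb G v ∩ nb G r).card : ℝ)}
  have h4 := prob_not_hasISTs_le (V := V) p (fun r => singletonCore V r) (a := 1)
    (m := p * n / 200) (by push_cast; linarith) ℰ (by
      rintro G ⟨hG, hcod⟩ r
      refine ⟨singletonCore_isGood r G, hG.exists_not_adj hp1 hn r, fun X hX hXc v hvr _ => ?_⟩
      push Not at hcod
      have h5 := hcod r v hvr (by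
        have := mul_le_mul_of_nonneg_left (hG r).1.le hp0
        rw [hu]; linarith)
      have h6 := card_le_card_missed_add (singletonCore_isGood r G).isRooted hX
        (Z := nb G r) (fun x hx => by simpa [singletonCore] using hX hx) v
      rw [hXc] at h6
      have h7 : (minDeg G : ℝ) ≤
          (missed G ((singletonCore V r).A G) X v).card + (nb G v ∩ nb G r).card := by
        exact_mod_cast h6
      have h8 := hG.lt_minDeg
      have h9 : (p : ℝ) * (p * n) ≤ 0.99 * (p * n) :=
        mul_le_mul_of_nonneg_right hp1 (by positivity)
      have h10 : 1000 * (p : ℝ) ≤ p * n := by nlinarith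
      rw [← hnd] at h8
      rw [hu] at h5
      linarith)
  have hsub : {G : SimpleGraph V | ¬ ∀ r, HasISTs G r (minDeg G)} ⊆
      ({G | ¬ NearlyRegular p G} ∪ {G | ∃ r v, v ≠ r ∧
        (p : ℝ) * (nb G r).card ≤ u ∧ (1 + 1 / 1000) * u ≤ ((nb G v ∩ nb G r).card : ℝ)}) ∪
      {G | G ∈ ℰ ∧ ¬ ∀ r, HasISTs G r (minDeg G)} := by
    intro G hG
    by_cases h5 : NearlyRegular p G
    · by_cases h6 : ∃ r v, v ≠ r ∧ (p : ℝ) * (nb G r).card ≤ u ∧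
        (1 + 1 / 1000) * u ≤ ((nb G v ∩ nb G r).card : ℝ)
      · exact Or.inl (Or.inr h6)
      · exact Or.inr ⟨⟨h5, h6⟩, hG⟩
    · exact Or.inl (Or.inl h5)
  have h5 := MeasureTheory.measureReal_mono (μ := G(V, p)) hsub
  have h6 := h5.trans ((MeasureTheory.measureReal_union_le _ _).trans
    (add_le_add (MeasureTheory.measureReal_union_le _ _) le_rfl))
  obtain ⟨h7, h8, -, -, -⟩ := mul_inv_pow_le (n := n) (by linarith)
  have h9 := mul_le_mul_of_nonneg_left (mul_le_mul_of_nonneg_left h3 hn0.le) hn0.le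
  have h10 : 0 < n⁻¹ := by positivity
  linarith

lemma exists_three_disjoint {V : Type*} [Fintype V] [DecidableEq V] {k : ℕ}
    (hk : 3 * k ≤ Fintype.card V) :
    ∃ U : Fin 3 → Finset V, (∀ i j, i ≠ j → Disjoint (U i) (U j)) ∧ ∀ i, (U i).card = k := by
  obtain ⟨A, -, hA⟩ := Finset.exists_subset_card_eq
    (show k ≤ (Finset.univ : Finset V).card by rw [Finset.card_univ]; omega)
  obtain ⟨B, hB, hBc⟩ := Finset.exists_subset_card_eq
    (show k ≤ (Aᶜ).card by rw [Finset.card_compl]; omega)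
  have hAB : Disjoint A B := Finset.disjoint_left.2 fun x hx hx' => Finset.mem_compl.1 (hB hx') hx
  obtain ⟨C, hC, hCc⟩ := Finset.exists_subset_card_eq
    (show k ≤ ((A ∪ B)ᶜ).card by
      rw [Finset.card_compl, Finset.card_union_of_disjoint hAB]; omega)
  have hAC : Disjoint A C := Finset.disjoint_left.2 fun x hx hx' =>
    Finset.mem_compl.1 (hC hx') (Finset.mem_union_left _ hx)
  have hBC : Disjoint B C := Finset.disjoint_left.2 fun x hx hx' =>
    Finset.mem_compl.1 (hC hx') (Finset.mem_union_right _ hx)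
  refine ⟨![A, B, C], ?_, ?_⟩
  · intro i j hij
    fin_cases i <;> fin_cases j <;>
      first
      | exact absurd rfl hij
      | simp [hAB, hAC, hBC, hAB.symm, hAC.symm, hBC.symm]
  · intro i
    fin_cases i <;> simp [hA, hBc, hCc]

/-- Larger cores compensate for the small value of p²n. The reservoirs have at most n/10 vertices in
total and codegrees are small, so v hits at most 2pn/5 cores and misses a constant fraction. -/
theorem prob_not_hasISTs_le_of_sparse {V : Type*} [Fintype V] (p : I)
    (hn : 10 ^ 4 ≤ Fintype.card V) (hp1 : (p : ℝ) ≤ 1 / 10 ^ 4)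
    (hp : 10 ^ 8 * Real.log (Fintype.card V) ≤ p * Fintype.card V) :
    G(V, p).real {G | ¬ ∀ r, HasISTs G r (minDeg G)} ≤ 100 * (Fintype.card V : ℝ)⁻¹ := by
  classical
  have hne : Nonempty V := Fintype.card_pos_iff.1 (by omega)
  set n : ℝ := (Fintype.card V : ℝ) with hnd
  have hn1 : (10 ^ 4 : ℝ) ≤ n := by rw [hnd]; exact_mod_cast hn
  have hn0 : 0 < n := by linarith
  set L : ℝ := Real.log n with hLd
  have hL : 1 ≤ L := by
    rw [hLd, Real.le_log_iff_exp_le hn0]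
    linarith [Real.exp_one_lt_d9]
  have hp0 : (0 : ℝ) < p := by
    by_contra! h
    nlinarith
  have hpn0 : 0 < (p : ℝ) * n := by positivity
  have hLp : L / p ≤ n / 10 ^ 8 := by
    rw [div_le_div_iff₀ hp0 (by positivity)]
    linarith
  obtain ⟨U, hUd, hUc⟩ := exists_three_disjoint (V := V) (k := Fintype.card V / 30) (by omega)
  set W : Finset V := Finset.univ.biUnion U with hW
  have hWc : (W.card : ℝ) ≤ n / 10 := by
    have h1 : W.card ≤ 3 * (Fintype.card V / 30) :=
      (Finset.card_biUnion_le_card_mul _ _ _ fun i _ => (hUc i).le).trans (by simp)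
    have h2 : 10 * W.card ≤ Fintype.card V := by omega
    have h3 : 10 * (W.card : ℝ) ≤ n := by rw [hnd]; exact_mod_cast h2
    linarith
  -- This a gives p·a·(pn/200) ≥ 40 log n for the parent matching. M exceeds twice the degree bound
  -- d by about 6pn, m is the linkedness threshold, and M·a + 3m vertices fit into a reservoir.
  set a : ℕ := ⌈8000 * L / (p * (p * n))⌉₊ with ha
  set M : ℕ := ⌈10 * (p * n)⌉₊ with hM
  set m : ℕ := ⌈10 * L / p⌉₊ with hm
  set d : ℕ := ⌊2 * (p * n)⌋₊ with hd
  have ha0 : 0 < a := Nat.ceil_pos.2 (by positivity)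
  have hm0 : 0 < m := Nat.ceil_pos.2 (by positivity)
  have hale : 8000 * L / (p * (p * n)) ≤ a := Nat.le_ceil _
  have haL : 8000 * L ≤ p * (a * (p * n)) := by
    rw [div_le_iff₀ (by positivity)] at hale
    linarith
  have ham : a ≤ m := by
    refine Nat.ceil_mono ?_
    rw [div_le_div_iff₀ (by positivity) hp0]
    have : 0 ≤ L * p := by positivity
    nlinarith
  have hmL : 10 * L ≤ p * m := by
    have : 10 * L / p ≤ m := Nat.le_ceil _
    rw [div_le_iff₀ hp0] at this
    linarith
  have hMl : 10 * (p * n) ≤ M := Nat.le_ceil _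
  have hMu : (M : ℝ) < 10 * (p * n) + 1 := Nat.ceil_lt_add_one (by positivity)
  have hau : (a : ℝ) < 8000 * L / (p * (p * n)) + 1 := Nat.ceil_lt_add_one (by positivity)
  have hmu : (m : ℝ) < 10 * L / p + 1 := Nat.ceil_lt_add_one (by positivity)
  have hdu : (d : ℝ) ≤ 2 * (p * n) := Nat.floor_le (by positivity)
  have hsize : M * a + 3 * m ≤ Fintype.card V / 30 := by
    have h1 : (M : ℝ) ≤ 11 * (p * n) := by linarith
    have h2 : (M : ℝ) * a ≤ 11 * (p * n) * (8000 * L / (p * (p * n)) + 1) :=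
      mul_le_mul h1 hau.le (by positivity) (by positivity)
    have h3 : 11 * (p * n) * (8000 * L / (p * (p * n)) + 1) = 88000 * (L / p) + 11 * (p * n) := by
      field_simp
      ring
    have h4 : (p : ℝ) * n ≤ 1 / 10 ^ 4 * n := mul_le_mul_of_nonneg_right hp1 hn0.le
    have h5 : 10 * L / (p : ℝ) = 10 * (L / p) := by ring
    have h6 : 30 * ((M : ℝ) * a + 3 * m) ≤ n := by
      rw [h5] at hmu
      linarith
    have h7 : 30 * (M * a + 3 * m) ≤ Fintype.card V := by
      rw [hnd] at h6
      exact_mod_cast h6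
    omega
  have hfirst : 10 * L ≤ p * (a * (M - (2 * d + 1))) := by
    have h1 : 5 * (p * n) ≤ (M : ℝ) - (2 * d + 1) := by linarith
    have h2 : (0 : ℝ) ≤ p * a := by positivity
    have h3 := mul_le_mul_of_nonneg_left h1 h2
    linarith
  set u : ℝ := p * n / 10 with hu
  have hu0 : 0 ≤ u := by positivity
  have hexp : Real.exp (-(1 ^ 2 * u / 8)) ≤ (n⁻¹) ^ 4 :=
    exp_neg_le_inv_pow hn0 (by rw [hu]; linarith)
  let E₁ : Set (SimpleGraph V) := {G | ¬ NearlyRegular p G}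
  let E₂ : Set (SimpleGraph V) := {G | ∃ v, (1 + 1) * u ≤ ((nb G v ∩ W).card : ℝ)}
  let E₃ : Set (SimpleGraph V) := {G | ∃ r v, v ≠ r ∧ (p : ℝ) * (nb G r).card ≤ u ∧
    (1 + 1) * u ≤ ((nb G v ∩ nb G r).card : ℝ)}
  let E₄ : Set (SimpleGraph V) := {G | ¬ IsLinked G m}
  let E₅ : Set (SimpleGraph V) := {G | ∃ i, G ∈ {G | (∃ 𝓑, IsSegments G (U i) a M 𝓑) ∧
    (∀ v, (nb G v).card ≤ d) ∧ ∃ r, ¬ HasSegmentMatching G r (U i) (segments G (U i) a M)}}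
  let ℰ : Set (SimpleGraph V) := {G | G ∉ E₁ ∧ G ∉ E₂ ∧ G ∉ E₃ ∧ G ∉ E₄ ∧ G ∉ E₅}
  have h1 : G(V, p).real E₁ ≤ 2 * n⁻¹ := prob_not_nearlyRegular_le p (by omega) hp
  have h2 : G(V, p).real E₂ ≤ n * Real.exp (-(1 ^ 2 * u / 8)) :=
    prob_exists_card_nb_inter_ge p one_pos le_rfl hu0 (by
      have := mul_le_mul_of_nonneg_left hWc hp0.le
      rw [hu]; linarith)
  have h3 : G(V, p).real E₃ ≤ n * (n * Real.exp (-(1 ^ 2 * u / 8))) :=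
    prob_exists_card_nb_inter_nb_ge p one_pos le_rfl hu0
  have h4 : G(V, p).real E₄ ≤ 9 * (n⁻¹) ^ 8 := prob_not_isLinked_le p hm0 hmL
  have h5 : G(V, p).real E₅ ≤ 3 * (n * (9 * (n⁻¹) ^ 8)) := by
    have := measureReal_exists_le G(V, p) _ fun i =>
      prob_not_hasSegmentMatching_le p (U i) (a := a) (M := M) (d := d) hfirst
    rw [Fintype.card_fin, Nat.cast_ofNat] at this
    exact this
  have h6 := prob_not_hasISTs_le (V := V) p (fun r => segmentCore U a r) (a := a)
    (m := p * n / 200) (by linarith) ℰ (by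
      rintro G ⟨g1, g2, g3, g4, g5⟩ r
      have hreg : NearlyRegular p G := not_not.1 g1
      have hlink : IsLinked G m := not_not.1 g4
      have hseg : ∀ i, ∃ 𝓑, IsSegments G (U i) a M 𝓑 := fun i =>
        hlink.exists_isSegments ha0 ham M (by rw [hUc i]; exact hsize)
      have hdeg : ∀ v, (nb G v).card ≤ d := fun v =>
        Nat.le_floor (by linarith [(hreg v).1])
      have hmatch : ∀ i, HasSegmentMatching G r (U i) (segments G (U i) a M) := fun i => by
        by_contra hno
        exact g5 ⟨i, hseg i, hdeg, r, hno⟩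
      have hcore := exists_isSegmentCore hUd (fun i => isSegments_segments (hseg i)) hmatch
      have hgood := segmentCore_isGood hUd hcore
      refine ⟨hgood, hreg.exists_not_adj (by linarith) (by omega) r, fun X hX hXc v hvr _ => ?_⟩
      have h7 := card_le_card_missed_add hgood.isRooted hX (Z := nb G r ∪ W) (fun x hx => by
        have hxr := hX hx
        refine (segmentCore_subset hcore (mem_nb.1 hxr)).trans (Finset.insert_subset ?_ ?_)
        · exact Finset.mem_union_left _ hxr
        · exact Finset.subset_union_right) v
      rw [hXc, Finset.inter_union_distrib_left] at h7
      have h8 := h7.trans (Nat.add_le_add_left (Finset.card_union_le _ _) _)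
      have h9 : (minDeg G : ℝ) ≤ (missed G ((segmentCore U a r).A G) X v).card +
          ((nb G v ∩ nb G r).card + (nb G v ∩ W).card) := by exact_mod_cast h8
      have h10 : ((nb G v ∩ W).card : ℝ) < (1 + 1) * u := by
        by_contra! h
        exact g2 ⟨v, h⟩
      have h11 : ((nb G v ∩ nb G r).card : ℝ) < (1 + 1) * u := by
        by_contra! h
        refine g3 ⟨r, v, hvr, ?_, h⟩
        have h12 := mul_le_mul hp1 (hreg r).1.le (by positivity) (by norm_num)
        rw [← hnd] at h12
        rw [hu]
        linarith
      have h12 := hreg.lt_minDeg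
      rw [← hnd] at h12
      rw [hu] at h10 h11
      linarith)
  have hsub : {G : SimpleGraph V | ¬ ∀ r, HasISTs G r (minDeg G)} ⊆
      ((((E₁ ∪ E₂) ∪ E₃) ∪ E₄) ∪ E₅) ∪ {G | G ∈ ℰ ∧ ¬ ∀ r, HasISTs G r (minDeg G)} := by
    intro G hG
    by_cases h : G ∈ (((E₁ ∪ E₂) ∪ E₃) ∪ E₄) ∪ E₅
    · exact Or.inl h
    · simp only [Set.mem_union, not_or] at h
      exact Or.inr ⟨⟨h.1.1.1.1, h.1.1.1.2, h.1.1.2, h.1.2, h.2⟩, hG⟩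
  have h7 := MeasureTheory.measureReal_mono (μ := G(V, p)) hsub
  have h8 := MeasureTheory.measureReal_union_le (μ := G(V, p)) ((((E₁ ∪ E₂) ∪ E₃) ∪ E₄) ∪ E₅)
    {G | G ∈ ℰ ∧ ¬ ∀ r, HasISTs G r (minDeg G)}
  have h9 := MeasureTheory.measureReal_union_le (μ := G(V, p)) (((E₁ ∪ E₂) ∪ E₃) ∪ E₄) E₅
  have h10 := MeasureTheory.measureReal_union_le (μ := G(V, p)) ((E₁ ∪ E₂) ∪ E₃) E₄
  have h11 := MeasureTheory.measureReal_union_le (μ := G(V, p)) (E₁ ∪ E₂) E₃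
  have h12 := MeasureTheory.measureReal_union_le (μ := G(V, p)) E₁ E₂
  obtain ⟨k1, k2, k3, k4, k5⟩ := mul_inv_pow_le (n := n) (by linarith)
  have h13 := mul_le_mul_of_nonneg_left hexp hn0.le
  have h14 := mul_le_mul_of_nonneg_left h13 hn0.le
  have h15 : 0 < n⁻¹ := by positivity
  linarith

/-! ### Passing to the limit -/

lemma Whp.mono {p : ℕ → I} {A B : ∀ n : ℕ, SimpleGraph (Fin n) → Prop} (hA : Whp p A)
    (h : ∀ᶠ n in atTop, ∀ G, A n G → B n G) : Whp p B := by
  refine tendsto_of_tendsto_of_tendsto_of_le_of_le' hA tendsto_const_nhds ?_ ?_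
  · filter_upwards [h] with n hn
    exact MeasureTheory.measure_mono fun G hG => hn G hG
  · exact Eventually.of_forall fun n => MeasureTheory.prob_le_one

lemma whp_of_real_compl_le {p : ℕ → I} {A : ∀ n : ℕ, SimpleGraph (Fin n) → Prop} {K : ℝ}
    (h : ∀ᶠ n : ℕ in atTop, G(Fin n, p n).real {G | ¬ A n G} ≤ K * (n : ℝ)⁻¹) : Whp p A := by
  have hlim : Tendsto (fun n : ℕ => ENNReal.ofReal (1 - K * (n : ℝ)⁻¹)) atTop (𝓝 1) := by
    have h1 : Tendsto (fun n : ℕ => 1 - K * (n : ℝ)⁻¹) atTop (𝓝 1) := by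
      simpa using (tendsto_inv_atTop_nhds_zero_nat (𝕜 := ℝ)).const_mul K |>.const_sub 1
    simpa using ENNReal.tendsto_ofReal h1
  refine tendsto_of_tendsto_of_tendsto_of_le_of_le' hlim tendsto_const_nhds ?_
    (Eventually.of_forall fun n => MeasureTheory.prob_le_one)
  filter_upwards [h] with n hn
  refine ENNReal.ofReal_le_of_le_toReal ?_
  change _ ≤ G(Fin n, p n).real {G | A n G}
  have h1 := MeasureTheory.measureReal_union_le (μ := G(Fin n, p n)) {G | A n G} {G | ¬ A n G}
  have h2 : ({G | A n G} ∪ {G | ¬ A n G} : Set (SimpleGraph (Fin n))) = Set.univ := by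
    ext G
    simp [em]
  rw [h2, MeasureTheory.probReal_univ] at h1
  linarith

end IST

theorem theorem1p2 :
    ∃ C : ℝ, 1 < C ∧ ∀ p : ℕ → unitInterval,
      (∀ᶠ n : ℕ in Filter.atTop,
        C * Real.log (n : ℝ) / (n : ℝ) ≤ (p n : ℝ) ∧ (p n : ℝ) ≤ (0.99 : ℝ)) →
      IST.Whp p (fun _ G => ∀ r, IST.HasISTs G r (IST.minDeg G)) ∧
      IST.Whp p (fun _ G => IST.connectivity G = IST.minDeg G) ∧
      IST.Whp p (fun _ G => IST.ZehaviItai G) := by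
  -- The size of C comes from the degree concentration with relative error 1/1000, whose exponent is
  -- pn/(8·10⁶) and must reach 4 log n.
  refine ⟨10 ^ 8, by norm_num, fun p hp => ?_⟩
  have hlog : ∀ᶠ n : ℕ in atTop, Real.log n ≤ 1 / 10 ^ 16 * n := by
    have h1 := (Real.isLittleO_log_id_atTop.comp_tendsto tendsto_natCast_atTop_atTop).bound
      (show (0 : ℝ) < 1 / 10 ^ 16 by norm_num)
    filter_upwards [h1] with n hn
    simp only [Function.comp_apply, id, Real.norm_eq_abs, Nat.abs_cast] at hn
    exact (le_abs_self _).trans hn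
  have hmain : IST.Whp p (fun _ G => ∀ r, IST.HasISTs G r (IST.minDeg G)) := by
    refine IST.whp_of_real_compl_le (K := 100) ?_
    filter_upwards [hp, hlog, eventually_ge_atTop (10 ^ 4)] with n hpn hlogn hn
    obtain ⟨hC, h99⟩ := hpn
    have hn0 : (0 : ℝ) < n := by
      have : (10 ^ 4 : ℝ) ≤ n := by exact_mod_cast hn
      linarith
    rw [div_le_iff₀ hn0] at hC
    by_cases hdense : 10 ^ 8 * Real.log n ≤ p n * (p n * n)
    · have := IST.prob_not_hasISTs_le_of_dense (V := Fin n) (p n)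
        (by rw [Fintype.card_fin]; omega) h99 (by rw [Fintype.card_fin]; exact hdense)
      rwa [Fintype.card_fin] at this
    -- Outside the dense regime p²n < 10⁸ log n ≤ 10⁻⁸ n, which forces p < 10⁻⁴.
    · have hsmall : (p n : ℝ) ≤ 1 / 10 ^ 4 := by
        push Not at hdense
        by_contra! hlt
        have h1 : (1 / 10 ^ 4 : ℝ) * (1 / 10 ^ 4) ≤ (p n : ℝ) * p n :=
          mul_le_mul hlt.le hlt.le (by norm_num) (by linarith)
        have h2 := mul_le_mul_of_nonneg_right h1 hn0.le
        linarith
      have := IST.prob_not_hasISTs_le_of_sparse (V := Fin n) (p n)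
        (by rw [Fintype.card_fin]; omega) hsmall (by rw [Fintype.card_fin]; exact hC)
      rwa [Fintype.card_fin] at this
  have hconn : ∀ᶠ n : ℕ in atTop, ∀ G : SimpleGraph (Fin n),
      (∀ r, IST.HasISTs G r (IST.minDeg G)) → IST.connectivity G = IST.minDeg G := by
    filter_upwards [eventually_ge_atTop 1] with n hn G hG
    have : Nonempty (Fin n) := ⟨⟨0, hn⟩⟩
    exact IST.connectivity_eq_minDeg hG
  refine ⟨hmain, hmain.mono hconn, hmain.mono ?_⟩
  filter_upwards [hconn] with n hn G hG r
  rw [hn G hG]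
  exact hG r
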